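/- Let $H$ be a separable Hilbert space over $\mathbb R$ or $\mathbb C$, let $\langle x,y\rangle$ denote the real part of its scalar product, and let $(S_t)_{t\in\mathbb R}$ be a $C_0$ unitary group on $H$ with skew-adjoint generator $A$, $Ax=\lim_{t\downarrow0}(S_tx-x)/t$. Fix $T>0$ and $\omega\in\mathbb R$. Put $L^2_H=L^2(0,T;H)$, and let $A^2_H$ be the space of absolutely continuous $u:[0,T]\to H$ with $\dot u\in L^2_H$. For $f:H\to\mathbb R\cup\{+\infty\}$ let $f^*(p)=\sup_x\{\langle x,p\rangle-f(x)\}$ be its Legendre conjugate and $\partial f$ its subdifferential. Let $\varphi:[0,T]\times H\to\mathbb R$ be such that $t\mapsto\varphi(t,x)$ is measurable for every $x$, and $\varphi(t,\cdot)$ is convex and everywhere Gateaux differentiable for every $t$; $\partial\varphi(t,x)\in H$ denotes its gradient and $\varphi^*(t,\cdot)$ its conjugate. Assume that for some $m,n>1$ and $C_1,C_2>0$, $$C_1\big(\|x\|_{L^2_H}^m-1\big)\le\int_0^T\{\varphi(t,x(t))+\varphi^*(t,0)\}\,dt\le C_2\big(1+\|x\|_{L^2_H}^n\big)\quad\text{for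 all }x\in L^2_H.$$ Let $\psi:H\to\mathbb R\cup\{+\infty\}$ be convex, lower semicontinuous and bounded below, with $\psi(0)<+\infty$. For $x\in A^2_H$ put $$I(x)=\int_0^Te^{-2\omega t}\{\varphi(t,e^{\omega t}S_tx(t))+\varphi^*(t,-e^{\omega t}S_t\dot x(t))\}\,dt+\psi(x(0)-x(T))+\psi^*\Big(-\frac{x(0)+x(T)}2\Big).$$ Then $I$ attains its minimum on $A^2_H$, and $\min_{A^2_H}I=0$. If $u\in A^2_H$ is a minimizer, i.e. $I(u)=0$, then $v(t)=S_te^{\omega t}u(t)$ is a mild solution of $\dot v-Av-\omega v=-\partial\varphi(t,v)$ on $[0,T]$, that is, $v$ is continuous, the integrand below is integrable, and $$v(t)=S_tv(0)-\int_0^tS_{t-s}\big(\partial\varphi(s,v(s))-\omega v(s)\big)\,ds\quad\text{for every }t\in[0,T],$$ and $$\frac{v(0)+S_{-T}e^{-\omega T}v(T)}2\in-\partial\psi\big(v(0)-S_{-T}e^{-\omega T}v(T)\big).$$ In particular, $v(0)=S_{-T}e^{-\omega T}v(T)$ if $\psi(0)=0$ and $\psi=+\infty$ on $H\setminus\{0\}$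 (periodic orbit up to an isometry), and $v(0)=-S_{-T}e^{-\omega T}v(T)$ if $\psi\equiv0$ (anti-periodic orbit up to an isometry). -/

import Mathlib

open MeasureTheory Filter Topology Set

noncomputable section

namespace SelfdualEvolution

/-- Lebesgue integral of an extended-real function: the integral of its positive part minus the
integral of its negative part. It is only used where the negative part has a finite integral. -/
def extIntegral (μ : Measure ℝ) (f : ℝ → EReal) : EReal :=
  ((∫⁻ t, (f t).toENNReal ∂μ : ENNReal) : EReal) - ((∫⁻ t, (-f t).toENNReal ∂μ : ENNReal) : EReal)

section Convex

variable (𝕜 : Type*) [RCLike 𝕜] {H : Type*} [NormedAddCommGroup H] [InnerProductSpace 𝕜 H]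

/-- Legendre-Fenchel conjugate with respect to the real scalar product `Re ⟪x, p⟫`. -/
def conjugate (f : H → EReal) (p : H) : EReal :=
  ⨆ x : H, ((RCLike.re (inner 𝕜 x p) : ℝ) : EReal) - f x

/-- Subdifferential of `f` at `x` with respect to the real scalar product
(empty outside the effective domain). -/
def subdifferential (f : H → EReal) (x : H) : Set H :=
  {p | f x ≠ ⊤ ∧ ∀ y : H, f x + ((RCLike.re (inner 𝕜 p (y - x)) : ℝ) : EReal) ≤ f y}

/-- `f` is Gateaux differentiable at `x`, with gradient `g` for the real scalar product. -/
def HasGateauxGradientAt [NormedSpace ℝ H] (f : H → ℝ) (g x : H) : Prop :=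
  ∀ h : H, HasDerivAt (fun s : ℝ => f (x + s • h)) (RCLike.re (inner 𝕜 g h)) 0

end Convex

/-- Convexity of an extended-real function: its epigraph is convex. -/
def EpiConvex {H : Type*} [NormedAddCommGroup H] [NormedSpace ℝ H] (f : H → EReal) : Prop :=
  Convex ℝ {q : H × ℝ | f q.1 ≤ (q.2 : EReal)}

section Group

variable {𝕜 : Type*} [RCLike 𝕜] {H : Type*} [NormedAddCommGroup H] [InnerProductSpace 𝕜 H]

/-- A strongly continuous one-parameter group of unitary operators. -/
structure IsC0UnitaryGroup (S : ℝ → H ≃ₗᵢ[𝕜] H) : Prop where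
  zero : ∀ x, S 0 x = x
  add : ∀ s t x, S (s + t) x = S s (S t x)
  continuous : ∀ x, Continuous fun t => S t x

/-- The (in general unbounded) operator `A` is densely defined and `A* = -A`. -/
def IsSkewAdjoint [CompleteSpace H] (A : H →ₗ.[𝕜] H) : Prop :=
  Dense (A.domain : Set H) ∧ A.adjoint = -A

/-- `A` is the infinitesimal generator of `S`: `x ∈ D(A)` and `A x = y` exactly when
`(S_t x - x) / t → y` as `t ↓ 0`. -/
def IsGenerator [NormedSpace ℝ H] (S : ℝ → H ≃ₗᵢ[𝕜] H) (A : H →ₗ.[𝕜] H) : Prop :=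
  ∀ x y : H, (x, y) ∈ A.graph ↔
    Tendsto (fun t : ℝ => t⁻¹ • (S t x - x)) (𝓝[>] 0) (𝓝 y)

end Group

/-- The path space `A²_H` on `[0, T]`: absolutely continuous arcs with square integrable
derivative, i.e. arcs that are the indefinite integral of an `L²` derivative.
(Values outside `[0, T]` play no role.) -/
def pathSpace {H : Type*} [NormedAddCommGroup H] [NormedSpace ℝ H] (T : ℝ) : Set (ℝ → H) :=
  {u | MemLp (deriv u) 2 (volume.restrict (Icc 0 T)) ∧
    ∀ t ∈ Icc 0 T, u t = u 0 + ∫ s in (0 : ℝ)..t, deriv u s}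

section Evolution

variable {𝕜 : Type*} [RCLike 𝕜] {H : Type*} [NormedAddCommGroup H] [InnerProductSpace 𝕜 H]
  [NormedSpace ℝ H]

/-- The functional
`I(x) = ∫₀ᵀ e^{-2ωt} {φ(t, e^{ωt} S_t x(t)) + φ*(t, -e^{ωt} S_t ẋ(t))} dt
  + ψ(x(0) - x(T)) + ψ*(-(x(0) + x(T)) / 2)`. -/
def selfdualFunctional (T ω : ℝ) (S : ℝ → H ≃ₗᵢ[𝕜] H) (φ : ℝ → H → ℝ) (ψ : H → EReal)
    (x : ℝ → H) : EReal :=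
  extIntegral (volume.restrict (Icc 0 T)) (fun t =>
      ((Real.exp (-2 * ω * t) : ℝ) : EReal) *
        (((φ t (Real.exp (ω * t) • S t (x t)) : ℝ) : EReal) +
          conjugate 𝕜 (fun y => ((φ t y : ℝ) : EReal)) (-(Real.exp (ω * t) • S t (deriv x t)))))
    + ψ (x 0 - x T)
    + conjugate 𝕜 ψ (-((1 / 2 : ℝ) • (x 0 + x T)))

/-- `v` is a mild solution on `[0, T]` for the group `S`, the rate `ω` and the vector field `F`:
`v(t) = S_t v(0) - ∫₀ᵗ S_{t-s} (F(s, v(s)) - ω v(s)) ds`, the integrands being integrable. -/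
def IsMildSolution (T ω : ℝ) (S : ℝ → H ≃ₗᵢ[𝕜] H) (F : ℝ → H → H) (v : ℝ → H) : Prop :=
  ContinuousOn v (Icc 0 T) ∧ ∀ t ∈ Icc 0 T,
    IntervalIntegrable (fun s => S (t - s) (F s (v s) - ω • v s)) volume 0 t ∧
    v t = S t (v 0) - ∫ s in (0 : ℝ)..t, S (t - s) (F s (v s) - ω • v s)

end Evolution

end SelfdualEvolution

end

/-! Nonnegativity. Since `S t` is an isometry, the weight `e^{-2ωt}` cancels the two factors
`e^{ωt}`, and Fenchel-Young bounds the integrand of `I` below by `-⟪x, ẋ⟫`. Its integral is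
`(‖x(0)‖² - ‖x(T)‖²)/2`, which is minus the pairing of `x(0) - x(T)` with `-(x(0) + x(T))/2`.
Fenchel-Young for `ψ` bounds the boundary terms below by that pairing, so `I ≥ 0`. If `I(u) = 0`,
both inequalities are equalities. Almost everywhere this gives `∂φ(t, e^{ωt} S_t u) = -e^{ωt} S_t
u̇`, hence the mild equation for `v`, and the boundary terms give the inclusion in `∂ψ`.

Existence. On `L²` put `F(x) = ∫ e^{-2ωt} (φ(t, e^{ωt} S_t x) + φ*(t, 0)) dt`, which is convex,
continuous, nonnegative and coercive. What is needed is an arc `u` with `-u̇ ∈ ∂F(u)` satisfying the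
boundary inclusion. `exists_selfdual_solution` finds it by duality. The inequality `I ≥ 0` says that
a convex set built from `F*`, `ψ` and `ψ*` lies below the graph of `F`. A separating affine function
has a slope `p`, which becomes `-u̇`. Coercivity then yields the best constant of integration, and a
second separation with Fenchel-Moreau shows that every Fenchel-Young inequality for this arc is an
equality.

Return to pointwise statements. `ae_forall_add_inner_le` turns the subgradient of `F` into pointwise
subgradients, and `selfdualIntegrand_eq_of_subgradient` removes the twist by `e^{ωt} S_t`. -/

noncomputable section

namespace SelfdualEvolution

/-! ### Convex separation, biconjugation and minimization in Hilbert space -/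

section Duality

/-- Sandwich theorem: an affine function separates a continuous convex function from a convex
set of points lying below its graph. -/
theorem exists_affine_between {X : Type*} [NormedAddCommGroup X] [NormedSpace ℝ X] {F : X → ℝ}
    (hF : ConvexOn ℝ univ F) (hc : Continuous F) {C : Set (X × ℝ)} (hC : Convex ℝ C)
    (hne : C.Nonempty) (h : ∀ q ∈ C, q.2 ≤ F q.1) :
    ∃ (p : X →L[ℝ] ℝ) (b : ℝ), (∀ x, p x + b ≤ F x) ∧ ∀ q ∈ C, q.2 ≤ p q.1 + b := by
  have hs₁ : Convex ℝ {q : X × ℝ | F q.1 < q.2} := by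
    simpa using hF.convex_strict_epigraph
  have hs₂ : IsOpen {q : X × ℝ | F q.1 < q.2} :=
    isOpen_lt (hc.comp continuous_fst) continuous_snd
  have hd : Disjoint {q : X × ℝ | F q.1 < q.2} C := by
    rw [Set.disjoint_left]
    intro q hq hqC
    exact absurd (h q hqC) (not_le.2 hq)
  obtain ⟨f, u, hf, hu⟩ := geometric_hahn_banach_open hs₁ hs₂ hC hd
  have hsplit : ∀ x r, f (x, r) = f (x, 0) + r * f (0, 1) := by
    intro x r
    have : ((x, r) : X × ℝ) = (x, 0) + r • (0, 1) := by simp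
    rw [this, map_add, map_smul, smul_eq_mul]
  obtain ⟨⟨y, r⟩, hy⟩ := hne
  set c := f (0, 1) with hcdef
  -- The hyperplane is not vertical: a point of `C` and a point of the strict epigraph lie over the
  -- same `y`, because `F` is finite everywhere.
  have hc0 : c < 0 := by
    have h1 := hf (y, F y + 1) (by simp)
    have h2 := hu _ hy
    have h3 := h _ hy
    rw [hsplit] at h1 h2
    simp only at h3
    by_contra hcc
    push Not at hcc
    nlinarith
  refine ⟨-(c⁻¹ • f.comp (ContinuousLinearMap.inl ℝ X ℝ)), u / c, fun x => ?_, fun q hq => ?_⟩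
  · have h1 : f (x, 0) + F x * c ≤ u := by
      refine le_of_forall_pos_le_add fun ε hε => ?_
      have := hf (x, F x + ε / (-c)) (by simp [div_pos hε (neg_pos.2 hc0)])
      rw [hsplit] at this
      have e : ε / (-c) * c = -ε := by
        rw [div_neg, neg_mul, div_mul_cancel₀ _ hc0.ne]
      nlinarith
    simp only [neg_apply, smul_apply,
      ContinuousLinearMap.comp_apply, ContinuousLinearMap.inl_apply, smul_eq_mul]
    rw [show -(c⁻¹ * f (x, 0)) + u / c = (u - f (x, 0)) / c by field_simp; ring,
      div_le_iff_of_neg hc0]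
    linarith
  · have h1 := hu q hq
    rw [show q = (q.1, q.2) from rfl, hsplit] at h1
    simp only [neg_apply, smul_apply,
      ContinuousLinearMap.comp_apply, ContinuousLinearMap.inl_apply, smul_eq_mul]
    rw [show -(c⁻¹ * f (q.1, 0)) + u / c = (u - f (q.1, 0)) / c by field_simp; ring,
      le_div_iff_of_neg hc0]
    linarith

variable {H : Type*} [NormedAddCommGroup H] [InnerProductSpace ℝ H]

local notation "⟪" x ", " y "⟫" => inner ℝ x y

/-- Riesz form of `exists_affine_between`. -/
theorem exists_inner_between [CompleteSpace H] {F : H → ℝ}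
    (hF : ConvexOn ℝ univ F) (hc : Continuous F) {C : Set (H × ℝ)} (hC : Convex ℝ C)
    (hne : C.Nonempty) (h : ∀ q ∈ C, q.2 ≤ F q.1) :
    ∃ (p : H) (b : ℝ), (∀ x, ⟪p, x⟫ + b ≤ F x) ∧ ∀ q ∈ C, q.2 ≤ ⟪p, q.1⟫ + b := by
  obtain ⟨p, b, h1, h2⟩ := exists_affine_between hF hc hC hne h
  refine ⟨(InnerProductSpace.toDual ℝ H).symm p, b, fun x => ?_, fun q hq => ?_⟩
  · simpa using h1 x
  · simpa using h2 q hq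

/-- The epigraph of the conjugate of the function whose epigraph is `E`. -/
def polarEpigraph (E : Set (H × ℝ)) : Set (H × ℝ) :=
  {q | ∀ z ∈ E, ⟪z.1, q.1⟫ ≤ z.2 + q.2}

theorem convex_polarEpigraph (E : Set (H × ℝ)) : Convex ℝ (polarEpigraph E) := by
  intro q hq r hr a b ha hb hab z hz
  have h1 := mul_le_mul_of_nonneg_left (hq z hz) ha
  have h2 := mul_le_mul_of_nonneg_left (hr z hz) hb
  simp only [Prod.fst_add, Prod.smul_fst, Prod.snd_add, Prod.smul_snd, inner_add_right,
    real_inner_smul_right, smul_eq_mul]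
  have : z.2 = a * z.2 + b * z.2 := by rw [← add_mul, hab, one_mul]
  linarith

/-- Fenchel-Moreau theorem for epigraphs of functions that are bounded below. -/
theorem mem_of_forall_polarEpigraph [CompleteSpace H] {E : Set (H × ℝ)} (hconv : Convex ℝ E)
    (hclosed : IsClosed E) (hup : ∀ x r s, (x, r) ∈ E → r ≤ s → (x, s) ∈ E)
    (hne : E.Nonempty) {c : ℝ} (hbdd : ∀ z ∈ E, c ≤ z.2) {y : H} {β : ℝ}
    (h : ∀ q ∈ polarEpigraph E, ⟪y, q.1⟫ ≤ β + q.2) : (y, β) ∈ E := by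
  by_contra hy
  obtain ⟨f, u, hfu, hu⟩ := geometric_hahn_banach_point_closed hconv hclosed hy
  have hsplit : ∀ x r, f (x, r) = f (x, 0) + r * f (0, 1) := by
    intro x r
    have : ((x, r) : H × ℝ) = (x, 0) + r • (0, 1) := by simp
    rw [this, map_add, map_smul, smul_eq_mul]
  set k := f (0, 1)
  obtain ⟨⟨x₀, r₀⟩, h₀⟩ := hne
  -- `E` is closed upwards, so a negative vertical coefficient would let `f` fall below `u` on `E`.
  have hk : 0 ≤ k := by
    by_contra hk
    push Not at hk
    have h1 := hu (x₀, r₀ + |u - f (x₀, r₀)| / (-k))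
      (hup _ _ _ h₀ (by have := neg_pos.2 hk; simp; positivity))
    rw [hsplit] at h1
    have e : |u - f (x₀, r₀)| / (-k) * k = -|u - f (x₀, r₀)| := by
      rw [div_neg, neg_mul, div_mul_cancel₀ _ hk.ne]
    have h2 := hsplit x₀ r₀
    have h3 := neg_abs_le (u - f (x₀, r₀))
    have h4 := hu _ h₀
    rw [abs_of_neg (by linarith)] at e
    rw [abs_of_neg (by linarith)] at h1
    nlinarith
  -- The hyperplane may be vertical (`k = 0`). Adding `ε` times the lower bound `c ≤ z.2` tilts it,
  -- and a small `ε` keeps `(y, β)` strictly on the wrong side.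
  obtain ⟨ε, hε, hε'⟩ : ∃ ε : ℝ, 0 < ε ∧ f (y, β) + ε * β < u + ε * c := by
    refine ⟨(u - f (y, β)) / (2 * (|β - c| + 1)), by have := sub_pos.2 hfu; positivity, ?_⟩
    have h1 : (u - f (y, β)) / (2 * (|β - c| + 1)) * (β - c) ≤
        (u - f (y, β)) / (2 * (|β - c| + 1)) * (|β - c| + 1) := by
      have := sub_pos.2 hfu
      gcongr
      linarith [le_abs_self (β - c)]
    have h2 : (u - f (y, β)) / (2 * (|β - c| + 1)) * (|β - c| + 1) = (u - f (y, β)) / 2 := by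
      field_simp
    linarith
  have hd : 0 < k + ε := by linarith
  set s := (InnerProductSpace.toDual ℝ H).symm (f.comp (ContinuousLinearMap.inl ℝ H ℝ))
  have hs : ∀ x, ⟪x, s⟫ = f (x, 0) := by
    intro x
    rw [real_inner_comm]
    simp [s]
  have hq : (-((k + ε)⁻¹ • s), -((u + ε * c) / (k + ε))) ∈ polarEpigraph E := by
    intro z hz
    have h1 := hu z hz
    rw [show z = (z.1, z.2) from rfl, hsplit] at h1
    have h2 := mul_le_mul_of_nonneg_left (hbdd z hz) hε.le
    simp only [inner_neg_right, real_inner_smul_right, hs]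
    rw [← sub_nonneg]
    have : z.2 + -((u + ε * c) / (k + ε)) - -((k + ε)⁻¹ * f (z.1, 0)) =
      (f (z.1, 0) + z.2 * (k + ε) - (u + ε * c)) / (k + ε) := by field_simp; ring
    rw [this]
    apply div_nonneg _ hd.le
    linarith
  have h1 := h _ hq
  simp only [inner_neg_right, real_inner_smul_right, hs] at h1
  rw [← sub_nonneg] at h1
  have : β + -((u + ε * c) / (k + ε)) - -((k + ε)⁻¹ * f (y, 0)) =
      (f (y, 0) + β * (k + ε) - (u + ε * c)) / (k + ε) := by field_simp; ring
  rw [this, div_nonneg_iff] at h1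
  have h3 := hsplit y β
  rcases h1 with h1 | h1 <;> linarith [h1.1, h1.2]

/-- Nested nonempty bounded closed convex sets in a Hilbert space have a common point. -/
theorem nonempty_iInter_of_antitone_convex [CompleteSpace H] {K : ℕ → Set H} (hanti : Antitone K)
    (hcl : ∀ k, IsClosed (K k)) (hcv : ∀ k, Convex ℝ (K k)) (hne : ∀ k, (K k).Nonempty)
    (hb : Bornology.IsBounded (K 0)) : (⋂ k, K k).Nonempty := by
  have hmin : ∀ k, ∃ x ∈ K k, ∀ y ∈ K k, ‖x‖ ^ 2 ≤ ‖y‖ ^ 2 := by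
    intro k
    obtain ⟨x, hx, hmin⟩ := exists_norm_eq_iInf_of_complete_convex (hne k)
      (hcl k).isComplete (hcv k) 0
    refine ⟨x, hx, fun y hy => ?_⟩
    simp only [zero_sub, norm_neg] at hmin
    have : ‖x‖ ≤ ‖y‖ := by
      rw [hmin]
      exact ciInf_le ⟨0, by rintro _ ⟨z, rfl⟩; exact norm_nonneg _⟩ (⟨y, hy⟩ : K k)
    gcongr
  choose x hx hxmin using hmin
  obtain ⟨R, hR⟩ := hb.exists_norm_le
  have hmono : Monotone fun k => ‖x k‖ ^ 2 := fun i j hij => hxmin i _ (hanti hij (hx j))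
  have hbd : BddAbove (range fun k => ‖x k‖ ^ 2) := by
    refine ⟨R ^ 2, ?_⟩
    rintro _ ⟨k, rfl⟩
    have := hR _ (hanti (Nat.zero_le k) (hx k))
    simp only
    gcongr
  have hlim := tendsto_atTop_ciSup hmono hbd
  -- The midpoint of `x i` and `x j` stays in `K i`, so its norm is at least `‖x i‖`; the
  -- parallelogram law then makes the points of least norm a Cauchy sequence.
  have hpar : ∀ i j, i ≤ j → ‖x i - x j‖ ^ 2 ≤ 2 * (‖x j‖ ^ 2 - ‖x i‖ ^ 2) := by
    intro i j hij
    have h1 := hxmin i ((1 / 2 : ℝ) • x i + (1 / 2 : ℝ) • x j)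
      (hcv i (hx i) (hanti hij (hx j)) (by norm_num) (by norm_num) (by norm_num))
    have h2 := parallelogram_law_with_norm ℝ (x i) (x j)
    rw [← smul_add, norm_smul] at h1
    norm_num at h1
    nlinarith
  have hcauchy : CauchySeq x := by
    rw [Metric.cauchySeq_iff']
    intro ε hε
    have hc := hlim.cauchySeq
    rw [Metric.cauchySeq_iff'] at hc
    obtain ⟨n, hn⟩ := hc (ε ^ 2 / 2) (by positivity)
    refine ⟨n, fun j hj => ?_⟩
    have h1 := hn j hj
    rw [Real.dist_eq, abs_of_nonneg (sub_nonneg.2 (hmono hj))] at h1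
    have h2 := hpar n j hj
    rw [dist_comm, dist_eq_norm]
    exact lt_of_pow_lt_pow_left₀ 2 hε.le (by simp only at h1; linarith)
  obtain ⟨y, hy⟩ := cauchySeq_tendsto_of_complete hcauchy
  refine ⟨y, mem_iInter.2 fun k => (hcl k).mem_of_tendsto hy ?_⟩
  filter_upwards [eventually_ge_atTop k] with j hj using hanti hj (hx j)

/-- The upper envelope of continuous convex functions attains its minimum
if its sublevel sets are bounded. -/
theorem exists_minimizer_of_envelope [CompleteSpace H] {ι : Type*} {g : ι → H → ℝ}
    (hcont : ∀ i, Continuous (g i)) (hconv : ∀ i, ConvexOn ℝ univ (g i))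
    {e₁ c : ℝ} {h₁ : H} (hfin : ∀ i, g i h₁ ≤ e₁)
    (hbelow : ∀ e h, (∀ i, g i h ≤ e) → c ≤ e)
    (hbdd : ∀ e, ∃ ρ, ∀ h, (∀ i, g i h ≤ e) → ‖h‖ ≤ ρ) :
    ∃ e₀ h₀, (∀ i, g i h₀ ≤ e₀) ∧ ∀ e h, (∀ i, g i h ≤ e) → e₀ ≤ e := by
  -- The envelope may be infinite at some points, so its infimum is taken over the real numbers that
  -- bound it somewhere.
  set V : Set ℝ := {e | ∃ h, ∀ i, g i h ≤ e}
  have hVne : V.Nonempty := ⟨e₁, h₁, hfin⟩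
  have hVb : BddBelow V := ⟨c, fun e ⟨h, hh⟩ => hbelow e h hh⟩
  set K : ℕ → Set H := fun k => {h | ∀ i, g i h ≤ sInf V + 1 / ((k : ℝ) + 1)}
  have hK : (⋂ k, K k).Nonempty := by
    apply nonempty_iInter_of_antitone_convex
    · intro k l hkl h hh i
      refine (hh i).trans ?_
      gcongr
    · intro k
      simp only [K, Set.ofPred_forall]
      exact isClosed_iInter fun i => isClosed_le (hcont i) continuous_const
    · intro k
      simp only [K, Set.ofPred_forall]
      refine convex_iInter fun i => ?_
      simpa using (hconv i).convex_le (sInf V + 1 / ((k : ℝ) + 1))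
    · intro k
      obtain ⟨e, ⟨h, hh⟩, he⟩ := exists_lt_of_csInf_lt hVne
        (show sInf V < sInf V + 1 / ((k : ℝ) + 1) by
          have : 0 < 1 / ((k : ℝ) + 1) := by positivity
          linarith)
      exact ⟨h, fun i => (hh i).trans he.le⟩
    · obtain ⟨ρ, hρ⟩ := hbdd (sInf V + 1 / (((0 : ℕ) : ℝ) + 1))
      exact isBounded_iff_forall_norm_le.2 ⟨ρ, fun h hh => hρ h hh⟩
  obtain ⟨h₀, hh₀⟩ := hK
  refine ⟨sInf V, h₀, fun i => ?_, fun e h hh => csInf_le hVb ⟨h, hh⟩⟩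
  have h1 : ∀ k : ℕ, g i h₀ ≤ sInf V + 1 / ((k : ℝ) + 1) := fun k => mem_iInter.1 hh₀ k i
  have h2 : Tendsto (fun k : ℕ => sInf V + 1 / ((k : ℝ) + 1)) atTop (𝓝 (sInf V + 0)) :=
    tendsto_const_nhds.add tendsto_one_div_add_atTop_nhds_zero_nat
  rw [add_zero] at h2
  exact ge_of_tendsto' h2 h1

end Duality

/-! ### The abstract selfdual principle -/

section Abstract

local notation "⟪" x ", " y "⟫" => inner ℝ x y

/-- Abstract selfdual variational principle: `J` plays the role of integration from the initial
time, `M` of integration over the whole interval, and `K` of the embedding of constants. -/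
theorem exists_selfdual_solution {X H : Type*}
    [NormedAddCommGroup X] [InnerProductSpace ℝ X] [CompleteSpace X]
    [NormedAddCommGroup H] [InnerProductSpace ℝ H] [CompleteSpace H]
    {J : X →ₗ[ℝ] X} {M : X →ₗ[ℝ] H} {K : H →L[ℝ] X}
    (hJ : ∀ f g, ⟪J f, g⟫ + ⟪f, J g⟫ = ⟪M f, M g⟫) (hK : ∀ h x, ⟪K h, x⟫ = ⟪h, M x⟫)
    {κ : ℝ} (hκ0 : 0 ≤ κ) (hκ : ∀ h, ‖h‖ ≤ κ * ‖K h‖)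
    {F : X → ℝ} (hF : ConvexOn ℝ univ F) (hFc : Continuous F) (hF0 : ∀ x, 0 ≤ F x)
    (hcoer : ∀ R, ∃ ρ, ∀ x, F x ≤ R → ‖x‖ ≤ ρ)
    {E : Set (H × ℝ)} (hconv : Convex ℝ E) (hclosed : IsClosed E)
    (hup : ∀ x r s, (x, r) ∈ E → r ≤ s → (x, s) ∈ E)
    {c β₀ : ℝ} (hbdd : ∀ z ∈ E, c ≤ z.2) (hβ₀ : ((0 : H), β₀) ∈ E) :
    ∃ (a : H) (p : X) (β γ : ℝ), (M p, β) ∈ E ∧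
      (-(a - (1 / 2 : ℝ) • M p), γ) ∈ polarEpigraph E ∧
      β + γ ≤ -⟪M p, a - (1 / 2 : ℝ) • M p⟫ ∧
      ∀ x, F (K a - J p) + ⟪p, x - (K a - J p)⟫ ≤ F x := by
  have hdiag : ∀ f, ⟪J f, f⟫ = (1 / 2) * ⟪M f, M f⟫ := by
    intro f
    have h1 := hJ f f
    have h2 := real_inner_comm f (J f)
    linarith
  have hpol0 : ((0 : H), -c) ∈ polarEpigraph E := by
    intro z hz
    have := hbdd z hz
    simp only [inner_zero_right]
    linarith
  -- first separation
  set C₁ : Set (X × ℝ) := {z | ∃ (a : H) (f : X) (α β γ : ℝ), (∀ x, -⟪x, f⟫ - F x ≤ α) ∧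
    (-M f, β) ∈ E ∧ (-(a + (1 / 2 : ℝ) • M f), γ) ∈ polarEpigraph E ∧
    z = (K a + J f, -(α + β + γ))} with hC₁
  have hC₁conv : Convex ℝ C₁ := by
    rintro _ ⟨a, f, α, β, γ, h1, h2, h3, rfl⟩ _ ⟨a', f', α', β', γ', h1', h2', h3', rfl⟩
      s t hs ht hst
    refine ⟨s • a + t • a', s • f + t • f', s * α + t * α', s * β + t * β', s * γ + t * γ',
      fun x => ?_, ?_, ?_, ?_⟩
    · have e1 := mul_le_mul_of_nonneg_left (h1 x) hs
      have e2 := mul_le_mul_of_nonneg_left (h1' x) ht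
      simp only [inner_add_right, real_inner_smul_right]
      have : F x = s * F x + t * F x := by rw [← add_mul, hst, one_mul]
      linarith
    · convert hconv h2 h2' hs ht hst using 1
      ext <;> simp
      abel
    · convert convex_polarEpigraph E h3 h3' hs ht hst using 1
      ext <;> simp
      module
    · ext
      · simp
        module
      · simp
        ring
  have hC₁ne : C₁.Nonempty := by
    refine ⟨_, 0, 0, 0, β₀, -c, fun x => ?_, ?_, ?_, rfl⟩
    · simpa using hF0 x
    · simpa using hβ₀
    · simpa using hpol0
  -- This is `I ≥ 0` for the arc `K a + J f` with derivative `f`. Here `α`, `β`, `γ` dominate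
  -- `F*(-f)`, `ψ` of the jump and `ψ*` of minus the midpoint, and the quadratic terms cancel by
  -- `hdiag`.
  have hC₁le : ∀ z ∈ C₁, z.2 ≤ F z.1 := by
    rintro _ ⟨a, f, α, β, γ, h1, h2, h3, rfl⟩
    have e1 := h1 (K a + J f)
    have e2 := h3 _ h2
    have e3 := hdiag f
    have e4 := hK a f
    have e5 := real_inner_comm a (M f)
    simp only [inner_add_left, inner_add_right, inner_neg_left, inner_neg_right,
      real_inner_smul_right] at e1 e2 ⊢
    linarith
  obtain ⟨p, b, hpF, hpC⟩ := exists_inner_between hF hFc hC₁conv hC₁ne hC₁le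
  -- the optimal mean value
  set r₀ : X := K ((1 / 2 : ℝ) • M p) - J p with hr₀
  -- Arcs with derivative `-p` are `r₀ - K h`, with midpoint `-h`. The quantity minimized over `h`
  -- is `F (r₀ - K h) + ψ*(h)`, with `ψ*` written as a supremum over `E`.
  obtain ⟨e₀, h₀, hh₀, he₀⟩ := exists_minimizer_of_envelope (ι := E)
    (g := fun z h => F (r₀ - K h) + (⟪z.1.1, h⟫ - z.1.2)) (c := -β₀) (e₁ := F r₀ - c) (h₁ := 0)
    (fun z => by fun_prop)
    (fun z => by
      refine ⟨convex_univ, fun h _ h' _ s t hs ht hst => ?_⟩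
      have e1 := hF.2 (mem_univ (r₀ - K h)) (mem_univ (r₀ - K h')) hs ht hst
      have e2 : s • (r₀ - K h) + t • (r₀ - K h') = r₀ - K (s • h + t • h') := by
        rw [map_add, map_smul, map_smul]
        have : r₀ = s • r₀ + t • r₀ := by rw [← add_smul, hst, one_smul]
        nth_rewrite 3 [this]
        module
      rw [e2] at e1
      simp only [smul_eq_mul, inner_add_right, real_inner_smul_right] at e1 ⊢
      have : z.1.2 = s * z.1.2 + t * z.1.2 := by rw [← add_mul, hst, one_mul]
      linarith)
    (fun z => by
      have := hbdd z.1 z.2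
      simp only [map_zero, sub_zero, inner_zero_right]
      linarith)
    (fun e h hh => by
      have e1 := hh ⟨_, hβ₀⟩
      have e2 := hF0 (r₀ - K h)
      simp only [inner_zero_left] at e1
      linarith)
    (fun e => by
      obtain ⟨ρ, hρ⟩ := hcoer (e + β₀)
      refine ⟨κ * (ρ + ‖r₀‖), fun h hh => (hκ h).trans ?_⟩
      have e1 := hh ⟨_, hβ₀⟩
      simp only [inner_zero_left] at e1
      have e2 := hρ (r₀ - K h) (by linarith)
      have e3 : ‖K h‖ ≤ ρ + ‖r₀‖ := by
        have := norm_sub_norm_le (K h) r₀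
        rw [norm_sub_rev (K h) r₀] at this
        linarith
      gcongr)
  have hmin : ∀ q ∈ polarEpigraph E, e₀ ≤ F (r₀ - K q.1) + q.2 := by
    intro q hq
    refine he₀ _ q.1 fun z => ?_
    have := hq z.1 z.2
    linarith
  -- second separation
  obtain ⟨w, b', hwF, hwC⟩ := exists_inner_between hF hFc
    (C := {z | ∃ q ∈ polarEpigraph E, z = (r₀ - K q.1, e₀ - q.2)})
    (by
      rintro _ ⟨q, hq, rfl⟩ _ ⟨q', hq', rfl⟩ s t hs ht hst
      refine ⟨s • q + t • q', convex_polarEpigraph E hq hq' hs ht hst, ?_⟩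
      ext
      · simp only [Prod.fst_add, Prod.smul_fst, map_add, map_smul]
        have : r₀ = s • r₀ + t • r₀ := by rw [← add_smul, hst, one_smul]
        nth_rewrite 3 [this]
        module
      · simp only [Prod.snd_add, Prod.smul_snd, smul_eq_mul]
        have : e₀ = s * e₀ + t * e₀ := by rw [← add_mul, hst, one_mul]
        linarith)
    ⟨_, _, hpol0, rfl⟩
    (by
      rintro _ ⟨q, hq, rfl⟩
      have := hmin q hq
      simp only
      linarith)
  have hKp : ∀ (x : X) (h : H), ⟪x, K h⟫ = ⟪M x, h⟫ := by
    intro x h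
    rw [real_inner_comm, hK, real_inner_comm]
  -- The second separation bounds the biconjugate of `ψ` at `M w`; Fenchel-Moreau turns this into a
  -- bound for `ψ`.
  have hw : (M w, ⟪w, r₀⟫ + b' - e₀) ∈ E := by
    refine mem_of_forall_polarEpigraph hconv hclosed hup ⟨_, hβ₀⟩ hbdd fun q hq => ?_
    have := hwC _ ⟨q, hq, rfl⟩
    simp only [inner_sub_right, hKp] at this
    linarith
  have hp : (M p, b - e₀) ∈ E := by
    refine mem_of_forall_polarEpigraph hconv hclosed hup ⟨_, hβ₀⟩ hbdd fun q hq => ?_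
    -- The first separation is tested on the arc with derivative `-w` and midpoint `-q.1`. By `hJ`
    -- all terms in `w` cancel, which leaves a bound for the biconjugate of `ψ` at `M p`.
    have h1 := hpC _ ⟨-q.1 + (1 / 2 : ℝ) • M w, -w, -b', ⟪w, r₀⟫ + b' - e₀, q.2, fun x => by
        have := hwF x
        rw [real_inner_comm] at this
        simp only [inner_neg_right]
        linarith, by simpa using hw, by simpa using hq, rfl⟩
    have h2 := hJ p w
    have h3 := real_inner_comm w (J p)
    simp only [hr₀, inner_add_right, inner_sub_right, inner_neg_right, hKp, map_neg,
      real_inner_smul_right] at h1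
    have h4 := real_inner_comm (M p) (M w)
    linarith
  have hq : (h₀, e₀ - F (r₀ - K h₀)) ∈ polarEpigraph E := by
    intro z hz
    have := hh₀ ⟨z, hz⟩
    simp only at this ⊢
    linarith
  set q := r₀ - K h₀ with hqdef
  -- The shift by `K ((1/2) • M p)` makes `r₀` orthogonal to `p`, so only the constant part of `q`
  -- contributes.
  have hpq : ⟪p, q⟫ = -⟪M p, h₀⟫ := by
    have h1 := hdiag p
    have h2 := real_inner_comm p (J p)
    simp only [hqdef, hr₀, inner_sub_right, hKp, real_inner_smul_right]
    linarith
  have ha : (1 / 2 : ℝ) • M p - h₀ - (1 / 2 : ℝ) • M p = -h₀ := by abel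
  have hKa : K ((1 / 2 : ℝ) • M p - h₀) - J p = q := by
    rw [hqdef, hr₀, map_sub]
    abel
  have h5 := hpF q
  -- Here `β + γ = b - F q`. The affine minorant of `F` gives `β + γ ≤ ⟪M p, h₀⟫`, and Fenchel-Young
  -- for the boundary pair gives the converse. So the minorant touches `F` at `q`, and `p` is a
  -- subgradient there.
  refine ⟨(1 / 2 : ℝ) • M p - h₀, p, b - e₀, e₀ - F q, hp, ?_, ?_, fun x => ?_⟩
  · rw [ha, neg_neg]
    exact hq
  · rw [ha, inner_neg_right]
    linarith
  · rw [hKa, inner_sub_right]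
    have h6 := hq _ hp
    simp only at h6
    have h7 := hpF x
    linarith

end Abstract

/-! ### Absolutely continuous Hilbert-valued arcs and integration by parts -/

section AbsoluteContinuity

theorem _root_.AbsolutelyContinuousOnInterval.of_dist_le {X Y : Type*} [PseudoMetricSpace X]
    [PseudoMetricSpace Y] {f : ℝ → X} {g : ℝ → Y} {a b : ℝ}
    (hg : AbsolutelyContinuousOnInterval g a b)
    (h : ∀ x ∈ uIcc a b, ∀ y ∈ uIcc a b, dist (f x) (f y) ≤ dist (g x) (g y)) :
    AbsolutelyContinuousOnInterval f a b := by
  refine squeeze_zero' (.of_forall fun E => Finset.sum_nonneg fun _ _ => dist_nonneg) ?_ hg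
  have : ∀ᶠ E in AbsolutelyContinuousOnInterval.totalLengthFilter ⊓
      𝓟 (AbsolutelyContinuousOnInterval.disjWithin a b),
      E ∈ AbsolutelyContinuousOnInterval.disjWithin a b :=
    eventually_inf_principal.mpr (by simp)
  filter_upwards [this] with E hE
  exact Finset.sum_le_sum fun i hi => h _ (hE.1 i hi).1 _ (hE.1 i hi).2

variable {T : ℝ}

theorem intervalIntegrable_of_mem_Icc {E : Type*} [NormedAddCommGroup E] {f : ℝ → E}
    (hf : IntervalIntegrable f volume 0 T) {x y : ℝ} (hx : x ∈ Icc 0 T) (hy : y ∈ Icc 0 T) :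
    IntervalIntegrable f volume x y := by
  apply hf.mono_set
  rw [uIcc_of_le (hx.1.trans hx.2)]
  exact uIcc_subset_Icc hx hy

variable {E : Type*} [NormedAddCommGroup E] [NormedSpace ℝ E] [CompleteSpace E]
variable {F : Type*} [NormedAddCommGroup F] [NormedSpace ℝ F] [CompleteSpace F]
variable {G : Type*} [NormedAddCommGroup G] [NormedSpace ℝ G] [CompleteSpace G]

/-- Fundamental theorem of calculus for functions whose increments are dominated by the integral of
an integrable function. -/
theorem sub_eq_integral_of_norm_sub_le (hT : 0 ≤ T) {z ζ : ℝ → G} {k : ℝ → ℝ}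
    (hk : IntervalIntegrable k volume 0 T) (hζ : IntervalIntegrable ζ volume 0 T)
    (hz : ∀ x ∈ Icc 0 T, ∀ y ∈ Icc 0 T, x ≤ y → ‖z y - z x‖ ≤ ∫ s in x..y, k s)
    (hd : ∀ᵐ t, t ∈ Icc 0 T → HasDerivAt z (ζ t) t) :
    ∀ t ∈ Icc 0 T, z t - z 0 = ∫ s in (0 : ℝ)..t, ζ s := by
  have h0 : (0 : ℝ) ∈ Icc 0 T := ⟨le_rfl, hT⟩
  have hK : IntervalIntegrable (fun s => k s + ‖ζ s‖) volume 0 T := hk.add hζ.norm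
  have hac := hK.absolutelyContinuousOnInterval_intervalIntegral (c := 0) left_mem_uIcc
  -- The increments of `z` minus the primitive of `ζ` are dominated by those of the primitive of `k
  -- + ‖ζ‖`. The difference is thus absolutely continuous with derivative zero a.e., hence constant.
  have hmain : ∀ x ∈ Icc 0 T, ∀ y ∈ Icc 0 T, x ≤ y →
      dist (z x - ∫ s in (0 : ℝ)..x, ζ s) (z y - ∫ s in (0 : ℝ)..y, ζ s) ≤
      dist (∫ s in (0 : ℝ)..x, (k s + ‖ζ s‖)) (∫ s in (0 : ℝ)..y, (k s + ‖ζ s‖)) := by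
    intro x hx y hy hxy
    have e1 := intervalIntegral.integral_interval_sub_left
      (intervalIntegrable_of_mem_Icc hζ h0 hy) (intervalIntegrable_of_mem_Icc hζ h0 hx)
    have e2 := intervalIntegral.integral_interval_sub_left
      (intervalIntegrable_of_mem_Icc hK h0 hy) (intervalIntegrable_of_mem_Icc hK h0 hx)
    have e3 := intervalIntegral.integral_add (intervalIntegrable_of_mem_Icc hk hx hy)
      (intervalIntegrable_of_mem_Icc hζ.norm hx hy)
    have e4 := intervalIntegral.norm_integral_le_integral_norm (f := ζ) (μ := volume) hxy
    have e5 := hz x hx y hy hxy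
    rw [dist_comm, dist_eq_norm, dist_comm, Real.dist_eq, e2, e3]
    have : z y - (∫ s in (0 : ℝ)..y, ζ s) - (z x - ∫ s in (0 : ℝ)..x, ζ s) =
        (z y - z x) - ∫ s in x..y, ζ s := by rw [← e1]; abel
    rw [this]
    exact (norm_sub_le _ _).trans ((add_le_add e5 e4).trans (le_abs_self _))
  have hac' : AbsolutelyContinuousOnInterval (fun x => z x - ∫ s in (0 : ℝ)..x, ζ s) 0 T := by
    refine hac.of_dist_le fun x hx y hy => ?_
    rw [uIcc_of_le hT] at hx hy
    rcases le_total x y with hxy | hxy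
    · exact hmain x hx y hy hxy
    · rw [dist_comm, dist_comm (∫ s in (0 : ℝ)..x, (k s + ‖ζ s‖))]
      exact hmain y hy x hx hxy
  obtain ⟨C, hC⟩ := hac'.const_of_ae_hasDerivAt_zero (by
    filter_upwards [hd, hζ.ae_hasDerivAt_integral] with t h1 h2 ht
    have := (h1 (by rwa [uIcc_of_le hT] at ht)).sub (h2 ht 0 left_mem_uIcc)
    rwa [sub_self] at this)
  intro t ht
  rw [uIcc_of_le hT] at hC
  have h1 := hC t ht
  have h2 := hC 0 h0
  simp only [intervalIntegral.integral_same, sub_zero] at h1 h2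
  rw [h2, ← h1]
  abel

omit [CompleteSpace E] in
theorem continuousOn_primitive {f : ℝ → E} (hT : 0 ≤ T) (hf : IntervalIntegrable f volume 0 T)
    (a : E) : ContinuousOn (fun t => a + ∫ s in (0 : ℝ)..t, f s) (Icc 0 T) := by
  have := intervalIntegral.continuousOn_primitive_interval (f := f) (a := 0) (b := T)
    (μ := volume) (by rw [uIcc_of_le hT, integrableOn_Icc_iff_integrableOn_Ioc]; exact hf.1)
  rw [uIcc_of_le hT] at this
  exact continuousOn_const.add this

omit [CompleteSpace E] [CompleteSpace F] [CompleteSpace G] in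
theorem intervalIntegrable_bilin (hT : 0 ≤ T) (B : E →L[ℝ] F →L[ℝ] G) {u : ℝ → E} {g : ℝ → F}
    (hu : ContinuousOn u (Icc 0 T)) (hg : IntervalIntegrable g volume 0 T) :
    IntervalIntegrable (fun s => B (u s) (g s)) volume 0 T := by
  rw [intervalIntegrable_iff_integrableOn_Icc_of_le hT] at hg ⊢
  obtain ⟨C, hC⟩ := (isCompact_Icc.image_of_continuousOn hu).isBounded.exists_norm_le
  have hm : AEStronglyMeasurable u (volume.restrict (Icc 0 T)) :=
    hu.aestronglyMeasurable measurableSet_Icc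
  refine Integrable.mono' (g := fun s => ‖B‖ * C * ‖g s‖) (hg.norm.const_mul _)
    (B.aestronglyMeasurable_comp₂ hm hg.aestronglyMeasurable) ?_
  filter_upwards [ae_restrict_mem measurableSet_Icc] with s hs
  refine (B.le_opNorm₂ _ _).trans ?_
  have := hC _ (mem_image_of_mem u hs)
  gcongr

/-- Integration by parts for absolutely continuous functions and a continuous bilinear map. -/
theorem bilin_sub_eq_integral (hT : 0 ≤ T) (B : E →L[ℝ] F →L[ℝ] G) {f : ℝ → E} {g : ℝ → F}
    (hf : IntervalIntegrable f volume 0 T) (hg : IntervalIntegrable g volume 0 T) {u : ℝ → E}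
    {w : ℝ → F} {a : E} {b : F} (hu : ∀ t, u t = a + ∫ s in (0 : ℝ)..t, f s)
    (hw : ∀ t, w t = b + ∫ s in (0 : ℝ)..t, g s) :
    ∀ t ∈ Icc 0 T, B (u t) (w t) - B (u 0) (w 0) =
      ∫ s in (0 : ℝ)..t, (B (u s) (g s) + B (f s) (w s)) := by
  have h0 : (0 : ℝ) ∈ Icc 0 T := ⟨le_rfl, hT⟩
  have huc : ContinuousOn u (Icc 0 T) := by
    rw [funext hu]; exact continuousOn_primitive hT hf a
  have hwc : ContinuousOn w (Icc 0 T) := by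
    rw [funext hw]; exact continuousOn_primitive hT hg b
  obtain ⟨C, hC⟩ := (isCompact_Icc.image_of_continuousOn huc).isBounded.exists_norm_le
  obtain ⟨D, hD⟩ := (isCompact_Icc.image_of_continuousOn hwc).isBounded.exists_norm_le
  refine sub_eq_integral_of_norm_sub_le hT
    (k := fun s => ‖B‖ * C * ‖g s‖ + ‖B‖ * D * ‖f s‖)
    ((hg.norm.const_mul _).add (hf.norm.const_mul _))
    ((intervalIntegrable_bilin hT B huc hg).add ?_) ?_ ?_
  · simpa using intervalIntegrable_bilin hT B.flip hwc hf
  · intro x hx y hy hxy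
    have e1 : u y - u x = ∫ s in x..y, f s := by
      rw [hu, hu, ← intervalIntegral.integral_interval_sub_left
        (intervalIntegrable_of_mem_Icc hf h0 hy) (intervalIntegrable_of_mem_Icc hf h0 hx)]
      abel
    have e2 : w y - w x = ∫ s in x..y, g s := by
      rw [hw, hw, ← intervalIntegral.integral_interval_sub_left
        (intervalIntegrable_of_mem_Icc hg h0 hy) (intervalIntegrable_of_mem_Icc hg h0 hx)]
      abel
    have e3 : B (u y) (w y) - B (u x) (w x) = B (u y) (w y - w x) + B (u y - u x) (w x) := by
      simp only [map_sub, sub_apply]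
      abel
    rw [e3, e1, e2, intervalIntegral.integral_add
      ((intervalIntegrable_of_mem_Icc hg hx hy).norm.const_mul _)
      ((intervalIntegrable_of_mem_Icc hf hx hy).norm.const_mul _),
      intervalIntegral.integral_const_mul, intervalIntegral.integral_const_mul]
    have b1 := hC _ (mem_image_of_mem u hy)
    have b2 := hD _ (mem_image_of_mem w hx)
    have hC0 := (norm_nonneg _).trans b1
    have hD0 := (norm_nonneg _).trans b2
    have e4 := intervalIntegral.norm_integral_le_integral_norm (f := f) (μ := volume) hxy
    have e5 := intervalIntegral.norm_integral_le_integral_norm (f := g) (μ := volume) hxy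
    refine (norm_add_le _ _).trans (add_le_add ?_ ?_)
    · refine (B.le_opNorm₂ _ _).trans ?_
      gcongr
    · refine (B.le_opNorm₂ _ _).trans ?_
      rw [mul_assoc, mul_assoc, mul_comm D]
      gcongr
      exact (norm_nonneg _).trans e4
  · filter_upwards [hf.ae_hasDerivAt_integral, hg.ae_hasDerivAt_integral] with t h1 h2 ht
    rw [uIcc_of_le hT] at h1 h2
    have h3 : HasDerivAt u (f t) t := by
      rw [funext hu]; exact (h1 ht 0 h0).const_add a
    have h4 : HasDerivAt w (g t) t := by
      rw [funext hw]; exact (h2 ht 0 h0).const_add b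
    exact B.hasDerivAt_of_bilinear (fun _ => h3) (fun _ => h4)

end AbsoluteContinuity

/-! ### The primitive, the total integral and the constants on `L²(0, T; H)` -/

section PathOperators

local notation "⟪" x ", " y "⟫" => inner ℝ x y

variable {H : Type*} [NormedAddCommGroup H] [InnerProductSpace ℝ H]

omit [InnerProductSpace ℝ H] in
theorem intervalIntegrable_of_memLp {T : ℝ} (hT : 0 ≤ T) {f : ℝ → H}
    (hf : MemLp f 2 (volume.restrict (Icc 0 T))) : IntervalIntegrable f volume 0 T := by
  rw [intervalIntegrable_iff_integrableOn_Icc_of_le hT]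
  exact hf.integrable one_le_two

omit [InnerProductSpace ℝ H] in
theorem memLp_of_continuousOn {T : ℝ} {u : ℝ → H} (hu : ContinuousOn u (Icc 0 T)) :
    MemLp u 2 (volume.restrict (Icc 0 T)) := by
  obtain ⟨C, hC⟩ := (isCompact_Icc.image_of_continuousOn hu).isBounded.exists_norm_le
  refine MemLp.of_bound (hu.aestronglyMeasurable measurableSet_Icc) C ?_
  filter_upwards [ae_restrict_mem measurableSet_Icc] with s hs
  exact hC _ (mem_image_of_mem u hs)

theorem memLp_primitive {T : ℝ} (hT : 0 ≤ T) (f : Lp H 2 (volume.restrict (Icc 0 T))) :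
    MemLp (fun t => ∫ s in (0 : ℝ)..t, f s) 2 (volume.restrict (Icc 0 T)) := by
  have := continuousOn_primitive hT (intervalIntegrable_of_memLp hT (Lp.memLp f)) 0
  simp only [zero_add] at this
  exact memLp_of_continuousOn this

/-- Integration over `[0, T]` on `L²(0, T; H)`. -/
def integralLp (H : Type*) [NormedAddCommGroup H] [InnerProductSpace ℝ H] (T : ℝ) :
    Lp H 2 (volume.restrict (Icc 0 T)) →ₗ[ℝ] H where
  toFun f := ∫ s in Icc 0 T, f s
  map_add' f g := by
    rw [integral_congr_ae (Lp.coeFn_add f g)]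
    exact integral_add ((Lp.memLp f).integrable one_le_two) ((Lp.memLp g).integrable one_le_two)
  map_smul' c f := by
    rw [integral_congr_ae (Lp.coeFn_smul c f)]
    exact integral_smul c _

theorem integralLp_apply {T : ℝ} (hT : 0 ≤ T) (f : Lp H 2 (volume.restrict (Icc 0 T))) :
    integralLp H T f = ∫ s in (0 : ℝ)..T, f s := by
  rw [intervalIntegral.integral_of_le hT, ← integral_Icc_eq_integral_Ioc]
  rfl

theorem intervalIntegral_congr_of_ae {T t : ℝ} (ht : t ∈ Icc 0 T) {f g : ℝ → H}
    (h : f =ᵐ[volume.restrict (Icc 0 T)] g) : ∫ s in (0 : ℝ)..t, f s = ∫ s in (0 : ℝ)..t, g s := by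
  apply intervalIntegral.integral_congr_ae
  filter_upwards [(ae_restrict_iff' measurableSet_Icc).1 h] with s hs hs'
  rw [uIoc_of_le ht.1] at hs'
  exact hs ⟨hs'.1.le, hs'.2.trans ht.2⟩

/-- The integral from the initial time on `L²(0, T; H)`. -/
def primitiveLp (H : Type*) [NormedAddCommGroup H] [InnerProductSpace ℝ H] {T : ℝ} (hT : 0 ≤ T) :
    Lp H 2 (volume.restrict (Icc 0 T)) →ₗ[ℝ] Lp H 2 (volume.restrict (Icc 0 T)) where
  toFun f := (memLp_primitive hT f).toLp _
  map_add' f g := by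
    rw [← MemLp.toLp_add]
    apply MemLp.toLp_congr
    filter_upwards [ae_restrict_mem measurableSet_Icc] with t ht
    have h0 : (0 : ℝ) ∈ Icc 0 T := ⟨le_rfl, hT⟩
    rw [intervalIntegral_congr_of_ae ht (Lp.coeFn_add f g)]
    exact intervalIntegral.integral_add
      (intervalIntegrable_of_mem_Icc (intervalIntegrable_of_memLp hT (Lp.memLp f)) h0 ht)
      (intervalIntegrable_of_mem_Icc (intervalIntegrable_of_memLp hT (Lp.memLp g)) h0 ht)
  map_smul' c f := by
    rw [RingHom.id_apply, ← MemLp.toLp_const_smul]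
    apply MemLp.toLp_congr
    filter_upwards [ae_restrict_mem measurableSet_Icc] with t ht
    rw [intervalIntegral_congr_of_ae ht (Lp.coeFn_smul c f)]
    exact intervalIntegral.integral_smul c _

theorem coeFn_primitiveLp {T : ℝ} (hT : 0 ≤ T) (f : Lp H 2 (volume.restrict (Icc 0 T))) :
    primitiveLp H hT f =ᵐ[volume.restrict (Icc 0 T)] fun t => ∫ s in (0 : ℝ)..t, f s :=
  (memLp_primitive hT f).coeFn_toLp

theorem integral_inner_eq_sub [CompleteSpace H] {T : ℝ} (hT : 0 ≤ T) {f g u w : ℝ → H} {a b : H}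
    (hf : IntervalIntegrable f volume 0 T) (hg : IntervalIntegrable g volume 0 T)
    (hu : ∀ t, u t = a + ∫ s in (0 : ℝ)..t, f s) (hw : ∀ t, w t = b + ∫ s in (0 : ℝ)..t, g s) :
    Integrable (fun s => ⟪u s, g s⟫) (volume.restrict (Icc 0 T)) ∧
    Integrable (fun s => ⟪f s, w s⟫) (volume.restrict (Icc 0 T)) ∧
    (∫ s in Icc 0 T, ⟪u s, g s⟫) + (∫ s in Icc 0 T, ⟪f s, w s⟫) = ⟪u T, w T⟫ - ⟪u 0, w 0⟫ := by
  have h1 : IntervalIntegrable (fun s => ⟪u s, g s⟫) volume 0 T := by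
    refine intervalIntegrable_bilin hT (innerSL ℝ) ?_ hg
    rw [funext hu]
    exact continuousOn_primitive hT hf a
  have h2 : IntervalIntegrable (fun s => ⟪f s, w s⟫) volume 0 T := by
    have e : (fun s => ⟪f s, w s⟫) = fun s => ⟪w s, f s⟫ :=
      funext fun s => real_inner_comm _ _
    rw [e]
    refine intervalIntegrable_bilin hT (innerSL ℝ) ?_ hf
    rw [funext hw]
    exact continuousOn_primitive hT hg b
  have h3 : ⟪u T, w T⟫ - ⟪u 0, w 0⟫ = ∫ s in (0 : ℝ)..T, (⟪u s, g s⟫ + ⟪f s, w s⟫) :=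
    bilin_sub_eq_integral hT (innerSL ℝ) hf hg hu hw T ⟨hT, le_rfl⟩
  rw [intervalIntegral.integral_add h1 h2] at h3
  rw [h3, intervalIntegral.integral_of_le hT, intervalIntegral.integral_of_le hT,
    integral_Icc_eq_integral_Ioc, integral_Icc_eq_integral_Ioc]
  rw [intervalIntegrable_iff_integrableOn_Icc_of_le hT] at h1 h2
  exact ⟨h1, h2, rfl⟩

/-- Integration by parts for two primitives that vanish at `0`, so that only the boundary term at
`T` survives. It supplies `hJ` of `exists_selfdual_solution`. -/
theorem inner_primitiveLp [CompleteSpace H] {T : ℝ} (hT : 0 ≤ T)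
    (f g : Lp H 2 (volume.restrict (Icc 0 T))) :
    ⟪primitiveLp H hT f, g⟫ + ⟪f, primitiveLp H hT g⟫ = ⟪integralLp H T f, integralLp H T g⟫ := by
  obtain ⟨-, -, h⟩ := integral_inner_eq_sub hT (a := 0) (b := 0)
    (u := fun t => 0 + ∫ s in (0 : ℝ)..t, f s) (w := fun t => 0 + ∫ s in (0 : ℝ)..t, g s)
    (intervalIntegrable_of_memLp hT (Lp.memLp f)) (intervalIntegrable_of_memLp hT (Lp.memLp g))
    (fun _ => rfl) (fun _ => rfl)
  simp only [zero_add, intervalIntegral.integral_same, inner_zero_left, sub_zero] at h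
  rw [integralLp_apply hT, integralLp_apply hT, ← h, L2.inner_def, L2.inner_def]
  congr 1
  · apply integral_congr_ae
    filter_upwards [coeFn_primitiveLp hT f] with t ht
    rw [ht]
  · apply integral_congr_ae
    filter_upwards [coeFn_primitiveLp hT g] with t ht
    rw [ht]

theorem inner_constL [CompleteSpace H] {T : ℝ} (h : H) (f : Lp H 2 (volume.restrict (Icc 0 T))) :
    ⟪Lp.constL 2 (volume.restrict (Icc 0 T)) ℝ h, f⟫ = ⟪h, integralLp H T f⟫ := by
  rw [L2.inner_def]
  have : ⟪h, integralLp H T f⟫ = ∫ s in Icc 0 T, ⟪h, f s⟫ :=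
    (integral_inner ((Lp.memLp f).integrable one_le_two) h).symm
  rw [this]
  apply integral_congr_ae
  filter_upwards [Lp.coeFn_const 2 (volume.restrict (Icc 0 T)) h] with s hs
  rw [Lp.constL_apply, hs]
  rfl

theorem norm_constL {T : ℝ} (hT : 0 < T) (h : H) :
    ‖h‖ ≤ (T ^ (1 / 2 : ℝ))⁻¹ * ‖Lp.constL 2 (volume.restrict (Icc 0 T)) ℝ h‖ := by
  rw [Lp.constL_apply, Lp.norm_const' _ _ _ (by norm_num) (by norm_num)]
  have h1 : (volume.restrict (Icc 0 T)).real univ = T := by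
    simp [hT.le]
  have h2 : 0 < T ^ (1 / 2 : ℝ) := by positivity
  rw [h1, ENNReal.toReal_ofNat, mul_comm ‖h‖, inv_mul_cancel_left₀ h2.ne']

/-- Selfdual variational principle on path space for an integral functional `F`. -/
theorem exists_selfdual_path [CompleteSpace H] {T : ℝ} (hT : 0 < T)
    {F : Lp H 2 (volume.restrict (Icc 0 T)) → ℝ}
    (hF : ConvexOn ℝ univ F) (hFc : Continuous F) (hF0 : ∀ x, 0 ≤ F x)
    (hcoer : ∀ R, ∃ ρ, ∀ x, F x ≤ R → ‖x‖ ≤ ρ)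
    {E : Set (H × ℝ)} (hconv : Convex ℝ E) (hclosed : IsClosed E)
    (hup : ∀ x r s, (x, r) ∈ E → r ≤ s → (x, s) ∈ E)
    {c β₀ : ℝ} (hbdd : ∀ z ∈ E, c ≤ z.2) (hβ₀ : ((0 : H), β₀) ∈ E) :
    ∃ (u u' : ℝ → H) (U P : Lp H 2 (volume.restrict (Icc 0 T))) (β γ : ℝ),
      MemLp u' 2 (volume.restrict (Icc 0 T)) ∧ (∀ t, u t = u 0 + ∫ s in (0 : ℝ)..t, u' s) ∧
      U =ᵐ[volume.restrict (Icc 0 T)] u ∧ (∀ s, P s = - u' s) ∧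
      (u 0 - u T, β) ∈ E ∧ (-((1 / 2 : ℝ) • (u 0 + u T)), γ) ∈ polarEpigraph E ∧
      β + γ ≤ ⟪u 0 - u T, -((1 / 2 : ℝ) • (u 0 + u T))⟫ ∧ ∀ x, F U + ⟪P, x - U⟫ ≤ F x := by
  obtain ⟨a, p, β, γ, h1, h2, h3, h4⟩ := exists_selfdual_solution
    (J := primitiveLp H hT.le) (M := integralLp H T)
    (K := Lp.constL 2 (volume.restrict (Icc 0 T)) ℝ)
    (inner_primitiveLp hT.le) inner_constL (inv_nonneg.2 (Real.rpow_nonneg hT.le (1 / 2)))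
    (norm_constL hT) hF hFc hF0 hcoer
    hconv hclosed hup hbdd hβ₀
  have huT : a + ∫ s in (0 : ℝ)..T, -p s = a - integralLp H T p := by
    rw [integralLp_apply hT.le, intervalIntegral.integral_neg, sub_eq_add_neg]
  have hm : a - (1 / 2 : ℝ) • integralLp H T p =
      (1 / 2 : ℝ) • (a + (a - integralLp H T p)) := by module
  -- The arc starts at `a` with derivative `-p`: its jump `u 0 - u T` is the integral of `p`, and
  -- its midpoint is `a` minus half of that integral.
  refine ⟨fun t => a + ∫ s in (0 : ℝ)..t, -p s, fun s => -p s, _, p, β, γ, (Lp.memLp p).neg,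
    fun t => by simp, ?_, fun s => by simp, ?_, ?_, ?_, h4⟩
  · filter_upwards [Lp.coeFn_sub (Lp.constL 2 (volume.restrict (Icc 0 T)) ℝ a)
      (primitiveLp H hT.le p), Lp.coeFn_const 2 (volume.restrict (Icc 0 T)) a,
      coeFn_primitiveLp hT.le p] with t e1 e2 e3
    rw [e1, Pi.sub_apply, Lp.constL_apply, e2, e3, intervalIntegral.integral_neg,
      ← sub_eq_add_neg]
    rfl
  · simp only [huT, intervalIntegral.integral_same, add_zero, sub_sub_cancel]
    exact h1
  · simp only [huT, intervalIntegral.integral_same, add_zero]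
    rwa [hm] at h2
  · simp only [huT, intervalIntegral.integral_same, add_zero]
    rw [hm] at h3
    rw [sub_sub_cancel, inner_neg_right]
    exact h3

end PathOperators

/-! ### Gateaux gradients of convex functions -/

section Gateaux

local notation "⟪" x ", " y "⟫" => inner ℝ x y

variable {H : Type*} [NormedAddCommGroup H] [InnerProductSpace ℝ H]

theorem HasGateauxGradientAt.add_inner_le {f : H → ℝ} {g x : H} (hf : ConvexOn ℝ univ f)
    (hg : HasGateauxGradientAt ℝ f g x) (y : H) : f x + ⟪g, y - x⟫ ≤ f y := by
  have h1 : ConvexOn ℝ univ fun s : ℝ => f (x + s • (y - x)) := by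
    refine ⟨convex_univ, fun s _ t _ a b ha hb hab => ?_⟩
    have h2 := hf.2 (mem_univ (x + s • (y - x))) (mem_univ (x + t • (y - x))) ha hb hab
    have e : a • (x + s • (y - x)) + b • (x + t • (y - x)) =
        x + (a • s + b • t) • (y - x) := by
      obtain rfl : b = 1 - a := by linarith
      simp only [smul_eq_mul]
      module
    rwa [e] at h2
  have h2 := h1.le_slope_of_hasDerivAt (mem_univ 0) (mem_univ 1) one_pos (hg (y - x))
  simp only [slope_def_field, one_smul, zero_smul, add_zero, sub_zero, div_one,
    add_sub_cancel] at h2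
  have h3 : (RCLike.re (inner ℝ g (y - x)) : ℝ) = ⟪g, y - x⟫ := rfl
  linarith

/-- Subtracting `⟪p, ·⟫` from `f` leaves a function minimal at `x`, so its derivative vanishes along
every line through `x`. -/
theorem eq_of_forall_add_inner_le {f : H → ℝ} {g p x : H} (hg : HasGateauxGradientAt ℝ f g x)
    (hp : ∀ y, f x + ⟪p, y - x⟫ ≤ f y) : p = g := by
  have h : ∀ h : H, ⟪g - p, h⟫ = 0 := by
    intro h
    have h1 : HasDerivAt (fun s : ℝ => f (x + s • h) - s * ⟪p, h⟫) (⟪g, h⟫ - 1 * ⟪p, h⟫) 0 :=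
      (hg h).sub ((hasDerivAt_id' (0 : ℝ)).mul_const _)
    have h2 : IsLocalMin (fun s : ℝ => f (x + s • h) - s * ⟪p, h⟫) 0 := by
      refine Filter.Eventually.of_forall fun s => ?_
      have := hp (x + s • h)
      rw [add_sub_cancel_left, real_inner_smul_right] at this
      simp only [zero_smul, add_zero, zero_mul, sub_zero]
      linarith
    rw [inner_sub_left]
    linarith [h2.hasDerivAt_eq_zero h1]
  exact (sub_eq_zero.1 (inner_self_eq_zero.1 (h (g - p)))).symm

/-- A convex function that is Gateaux differentiable everywhere on a Hilbert space is
continuous. -/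
theorem continuous_of_hasGateauxGradientAt [CompleteSpace H] {f : H → ℝ} {df : H → H}
    (hf : ConvexOn ℝ univ f) (hg : ∀ x, HasGateauxGradientAt ℝ f (df x) x) : Continuous f := by
  -- `f` is the supremum of its tangent affine functions, so its sublevel sets are closed. By Baire
  -- one of them has an interior point, and a convex function bounded above near a point is
  -- continuous.
  have hset : ∀ k : ℕ, {x | f x ≤ k} = ⋂ y, {x | f y + ⟪df y, x - y⟫ ≤ k} := by
    intro k
    ext x
    simp only [mem_ofPred_eq, mem_iInter]
    refine ⟨fun h y => ((hg y).add_inner_le hf x).trans h, fun h => ?_⟩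
    simpa using h x
  have hcl : ∀ k : ℕ, IsClosed {x | f x ≤ k} := by
    intro k
    rw [hset]
    exact isClosed_iInter fun y => isClosed_le (by fun_prop) continuous_const
  obtain ⟨k, x₀, hx₀⟩ := nonempty_interior_of_iUnion_of_closed hcl (by
    ext x
    simpa using exists_nat_ge (f x))
  have h3 : ∃ x₀ ∈ (univ : Set H), (𝓝 x₀).IsBoundedUnder (· ≤ ·) f :=
    ⟨x₀, mem_univ _, k, by
      rw [eventually_map]
      exact mem_of_superset (mem_interior_iff_mem_nhds.1 hx₀) fun x hx => hx⟩
  exact continuousOn_univ.1 (((hf.continuousOn_tfae isOpen_univ univ_nonempty).out 3 1).1 h3)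

end Gateaux

/-! ### Legendre conjugates with extended values -/

section Conjugate

local notation "⟪" x ", " y "⟫" => inner ℝ x y

variable {H : Type*} [NormedAddCommGroup H] [InnerProductSpace ℝ H]

/-- The bridge to `polarEpigraph`. Quantifying over real majorants `r` of `f x` treats the values
`⊤` and `⊥` uniformly. -/
theorem conjugate_le_iff {f : H → EReal} {p : H} {γ : ℝ} :
    conjugate ℝ f p ≤ γ ↔ ∀ (x : H) (r : ℝ), f x ≤ r → ⟪x, p⟫ ≤ r + γ := by
  simp only [conjugate, iSup_le_iff]
  refine forall_congr' fun x => ?_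
  have e : (RCLike.re (inner ℝ x p) : ℝ) = ⟪x, p⟫ := rfl
  rw [e]
  induction h : f x with
  | bot =>
    simp only [EReal.coe_sub_bot, top_le_iff, EReal.coe_ne_top, bot_le, forall_const, false_iff,
      not_forall, not_le]
    exact ⟨⟪x, p⟫ - γ - 1, by linarith⟩
  | top => simp
  | coe a =>
    rw [← EReal.coe_sub, EReal.coe_le_coe_iff]
    refine ⟨fun h r hr => ?_, fun h => ?_⟩
    · have := EReal.coe_le_coe_iff.1 hr
      linarith
    · have := h a le_rfl
      linarith

theorem sub_le_conjugate (f : H → ℝ) (x p : H) :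
    ((⟪x, p⟫ - f x : ℝ) : EReal) ≤ conjugate ℝ (fun y => ((f y : ℝ) : EReal)) p := by
  rw [EReal.coe_sub]
  exact le_iSup (fun x : H => ((⟪x, p⟫ : ℝ) : EReal) - f x) x

theorem conjugate_eq_of_forall_add_inner_le {f : H → ℝ} {x p : H}
    (hp : ∀ y, f x + ⟪p, y - x⟫ ≤ f y) :
    conjugate ℝ (fun y => ((f y : ℝ) : EReal)) p = ((⟪x, p⟫ - f x : ℝ) : EReal) := by
  refine le_antisymm (conjugate_le_iff.2 fun y r hr => ?_) (sub_le_conjugate f x p)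
  have h1 := hp y
  have h2 := EReal.coe_le_coe_iff.1 hr
  rw [inner_sub_right, real_inner_comm, real_inner_comm x p] at h1
  linarith

theorem forall_add_inner_le_of_conjugate_le {f : H → ℝ} {x p : H}
    (h : conjugate ℝ (fun y => ((f y : ℝ) : EReal)) p ≤ ((⟪x, p⟫ - f x : ℝ) : EReal)) (y : H) :
    f x + ⟪p, y - x⟫ ≤ f y := by
  have h1 := conjugate_le_iff.1 h y (f y) le_rfl
  rw [inner_sub_right, real_inner_comm, real_inner_comm x p]
  linarith

theorem conjugate_eq_iSup_denseSeq [TopologicalSpace.SeparableSpace H] {f : H → ℝ}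
    (hf : Continuous f) (p : H) :
    conjugate ℝ (fun y => ((f y : ℝ) : EReal)) p =
      ⨆ k : ℕ, ((⟪TopologicalSpace.denseSeq H k, p⟫ - f (TopologicalSpace.denseSeq H k) : ℝ) :
        EReal) := by
  refine le_antisymm (iSup_le fun x => ?_) (iSup_le fun k => sub_le_conjugate f _ p)
  have hcl : IsClosed {x : H | ((⟪x, p⟫ - f x : ℝ) : EReal) ≤
      ⨆ k : ℕ, ((⟪TopologicalSpace.denseSeq H k, p⟫ - f (TopologicalSpace.denseSeq H k) : ℝ) :
        EReal)} :=
    isClosed_le (continuous_coe_real_ereal.comp (by fun_prop)) continuous_const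
  have hsub : range (TopologicalSpace.denseSeq H) ⊆ {x : H | ((⟪x, p⟫ - f x : ℝ) : EReal) ≤
      ⨆ k : ℕ, ((⟪TopologicalSpace.denseSeq H k, p⟫ - f (TopologicalSpace.denseSeq H k) : ℝ) :
        EReal)} := by
    rintro _ ⟨k, rfl⟩
    exact le_iSup (fun k : ℕ => ((⟪TopologicalSpace.denseSeq H k, p⟫ -
      f (TopologicalSpace.denseSeq H k) : ℝ) : EReal)) k
  have := hcl.closure_subset_iff.2 hsub
    ((TopologicalSpace.denseRange_denseSeq H).closure_range ▸ mem_univ x)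
  rw [mem_ofPred_eq, EReal.coe_sub] at this
  exact this

end Conjugate

/-! ### Measurability of the integrands -/

section Caratheodory

variable {H : Type*} [NormedAddCommGroup H]

/-- Composition of a Caratheodory function with a measurable function is measurable. -/
theorem aemeasurable_caratheodory {μ : Measure ℝ} {φ : ℝ → H → ℝ}
    (hmeas : ∀ x, AEMeasurable (fun t => φ t x) μ) (hcont : ∀ᵐ t ∂μ, Continuous (φ t))
    {y : ℝ → H} (hy : AEStronglyMeasurable y μ) : AEMeasurable (fun t => φ t (y t)) μ := by
  have hs : ∀ s : SimpleFunc ℝ H, AEMeasurable (fun t => φ t (s t)) μ := by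
    intro s
    classical
    have : (fun t => φ t (s t)) =
        fun t => ∑ c ∈ s.range, (s ⁻¹' {c}).indicator (fun t => φ t c) t := by
      funext t
      rw [Finset.sum_eq_single (s t)]
      · simp
      · intro c _ hc
        exact indicator_of_notMem (by simpa using hc.symm) _
      · intro h
        exact absurd (s.mem_range_self t) h
    rw [this]
    exact Finset.aemeasurable_fun_sum _ fun c _ => (hmeas c).indicator (s.measurableSet_preimage _)
  refine aemeasurable_of_tendsto_metrizable_ae atTop
    (fun n => hs (hy.stronglyMeasurable_mk.approx n)) ?_
  filter_upwards [hcont, hy.ae_eq_mk] with t ht hyt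
  rw [hyt]
  exact (ht.tendsto _).comp (hy.stronglyMeasurable_mk.tendsto_approx t)

/-- By continuity the supremum defining the conjugate may be taken over a countable dense set. -/
theorem aemeasurable_conjugate [InnerProductSpace ℝ H] [TopologicalSpace.SeparableSpace H]
    {μ : Measure ℝ} {φ : ℝ → H → ℝ}
    (hmeas : ∀ x, AEMeasurable (fun t => φ t x) μ) (hcont : ∀ᵐ t ∂μ, Continuous (φ t))
    {p : ℝ → H} (hp : AEStronglyMeasurable p μ) :
    AEMeasurable (fun t => conjugate ℝ (fun y => ((φ t y : ℝ) : EReal)) (p t)) μ := by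
  refine AEMeasurable.congr (f := fun t => ⨆ k : ℕ,
    ((inner ℝ (TopologicalSpace.denseSeq H k) (p t) - φ t (TopologicalSpace.denseSeq H k) : ℝ) :
        EReal)) ?_ ?_
  · refine AEMeasurable.iSup fun k => ?_
    exact (((aestronglyMeasurable_const.inner hp).aemeasurable).sub (hmeas _)).coe_real_ereal
  · filter_upwards [hcont] with t ht
    exact (conjugate_eq_iSup_denseSeq ht _).symm

end Caratheodory

/-! ### Extended-real integrals -/

section ExtIntegral

theorem extIntegral_of_nonneg {μ : Measure ℝ} {h : ℝ → EReal} (hh : ∀ᵐ t ∂μ, 0 ≤ h t) :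
    extIntegral μ h = ((∫⁻ t, (h t).toENNReal ∂μ : ENNReal) : EReal) := by
  have : ∫⁻ t, (-h t).toENNReal ∂μ = 0 := by
    rw [← lintegral_zero (μ := μ)]
    apply lintegral_congr_ae
    filter_upwards [hh] with t ht
    exact EReal.toENNReal_of_nonpos (by rwa [EReal.neg_le, neg_zero])
  rw [extIntegral, this]
  simp

theorem extIntegral_congr {μ : Measure ℝ} {f g : ℝ → EReal} (h : f =ᵐ[μ] g) :
    extIntegral μ f = extIntegral μ g := by
  have h1 : ∫⁻ t, (f t).toENNReal ∂μ = ∫⁻ t, (g t).toENNReal ∂μ := by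
    apply lintegral_congr_ae
    filter_upwards [h] with t ht
    rw [ht]
  have h2 : ∫⁻ t, (-f t).toENNReal ∂μ = ∫⁻ t, (-g t).toENNReal ∂μ := by
    apply lintegral_congr_ae
    filter_upwards [h] with t ht
    rw [ht]
  rw [extIntegral, extIntegral, h1, h2]

theorem extIntegral_coe {μ : Measure ℝ} {l : ℝ → ℝ} (hl : Integrable l μ) :
    extIntegral μ (fun t => ((l t : ℝ) : EReal)) = ((∫ t, l t ∂μ : ℝ) : EReal) := by
  rw [integral_eq_lintegral_pos_part_sub_lintegral_neg_part hl, EReal.coe_sub,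
    EReal.coe_ennreal_toReal hl.lintegral_lt_top.ne,
    EReal.coe_ennreal_toReal (x := ∫⁻ t, ENNReal.ofReal (-l t) ∂μ) hl.neg.lintegral_lt_top.ne]
  rfl

theorem coe_integral_le_extIntegral {μ : Measure ℝ} {l : ℝ → ℝ} {h : ℝ → EReal}
    (hl : Integrable l μ) (hlh : ∀ᵐ t ∂μ, ((l t : ℝ) : EReal) ≤ h t) :
    ((∫ t, l t ∂μ : ℝ) : EReal) ≤ extIntegral μ h := by
  rw [← extIntegral_coe hl]
  refine EReal.sub_le_sub ?_ ?_
  · refine EReal.coe_ennreal_le_coe_ennreal_iff.2 (lintegral_mono_ae ?_)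
    filter_upwards [hlh] with t ht using EReal.toENNReal_le_toENNReal ht
  · refine EReal.coe_ennreal_le_coe_ennreal_iff.2 (lintegral_mono_ae ?_)
    filter_upwards [hlh] with t ht using EReal.toENNReal_le_toENNReal (EReal.neg_le_neg_iff.2 ht)

theorem eq_toENNReal_sub (x : EReal) : x = (x.toENNReal : EReal) - ((-x).toENNReal : EReal) := by
  rcases le_total 0 x with h | h
  · rw [EReal.coe_toENNReal h, EReal.toENNReal_of_nonpos (by rwa [EReal.neg_le, neg_zero])]
    simp
  · have h' : 0 ≤ -x := by rwa [EReal.le_neg, neg_zero]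
    rw [EReal.coe_toENNReal h', EReal.toENNReal_of_nonpos h]
    simp

/-- The positive part of `h` dominates that of `l`, and its negative part is dominated. The reverse
inequality of integrals forces equality of both pairs of finite integrals, hence of the parts a.e.
-/
theorem ae_eq_of_extIntegral_le {μ : Measure ℝ} {l : ℝ → ℝ} {h : ℝ → EReal}
    (hl : Integrable l μ) (hm : AEMeasurable h μ) (hlh : ∀ᵐ t ∂μ, ((l t : ℝ) : EReal) ≤ h t)
    (hle : extIntegral μ h ≤ ((∫ t, l t ∂μ : ℝ) : EReal)) :
    ∀ᵐ t ∂μ, h t = ((l t : ℝ) : EReal) := by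
  have hp : (fun t => ((l t : ℝ) : EReal).toENNReal) ≤ᵐ[μ] fun t => (h t).toENNReal := by
    filter_upwards [hlh] with t ht using EReal.toENNReal_le_toENNReal ht
  have hn : (fun t => (-h t).toENNReal) ≤ᵐ[μ] fun t => (-((l t : ℝ) : EReal)).toENNReal := by
    filter_upwards [hlh] with t ht using EReal.toENNReal_le_toENNReal (EReal.neg_le_neg_iff.2 ht)
  rw [← extIntegral_coe hl, extIntegral, extIntegral] at hle
  have i1 := lintegral_mono_ae hp
  have i2 := lintegral_mono_ae hn
  have f1 : ∫⁻ t, ((l t : ℝ) : EReal).toENNReal ∂μ ≠ ⊤ := hl.lintegral_lt_top.ne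
  have f2 : ∫⁻ t, (-((l t : ℝ) : EReal)).toENNReal ∂μ ≠ ⊤ := hl.neg.lintegral_lt_top.ne
  have f3 := ne_top_of_le_ne_top f2 i2
  have hlm := hl.aestronglyMeasurable.aemeasurable.coe_real_ereal
  generalize hA : ∫⁻ t, (h t).toENNReal ∂μ = A at *
  generalize hB : ∫⁻ t, (-h t).toENNReal ∂μ = B at *
  generalize ha : ∫⁻ t, ((l t : ℝ) : EReal).toENNReal ∂μ = a at *
  generalize hb : ∫⁻ t, (-((l t : ℝ) : EReal)).toENNReal ∂μ = b at *
  lift a to NNReal using f1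
  lift b to NNReal using f2
  lift B to NNReal using f3
  have f4 : A ≠ ⊤ := by
    rintro rfl
    exact absurd hle (by
      rw [not_le]
      exact_mod_cast EReal.coe_lt_top ((a : ℝ) - b))
  lift A to NNReal using f4
  have hle' : (A : ℝ) - B ≤ a - b := by
    simp only [EReal.coe_nnreal_eq_coe_real] at hle
    exact_mod_cast hle
  have i1' : (a : ℝ) ≤ A := by exact_mod_cast i1
  have i2' : (B : ℝ) ≤ b := by exact_mod_cast i2
  have e1 : A = a := by
    apply NNReal.eq; linarith
  have e2 : B = b := by
    apply NNReal.eq; linarith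
  have g1 := ae_eq_of_ae_le_of_lintegral_le hp (by rw [ha]; simp) hm.ereal_toENNReal
    (by rw [hA, ha, e1])
  have g2 := ae_eq_of_ae_le_of_lintegral_le hn (by rw [hB]; simp) hlm.neg.ereal_toENNReal
    (by rw [hB, hb, e2])
  filter_upwards [g1, g2] with t k1 k2
  rw [eq_toENNReal_sub (h t), eq_toENNReal_sub ((l t : ℝ) : EReal), ← k1, k2]

end ExtIntegral

/-! ### From subgradients on `L²` to pointwise subgradients -/

section Localization

local notation "⟪" x ", " y "⟫" => inner ℝ x y

variable {H : Type*} [NormedAddCommGroup H] [InnerProductSpace ℝ H]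
  [TopologicalSpace.SeparableSpace H]

/-- A subgradient of an integral functional on `L²` is a pointwise subgradient. -/
theorem ae_forall_add_inner_le {μ : Measure ℝ} [IsFiniteMeasure μ] {Φ : ℝ → H → ℝ}
    (hint : ∀ x : Lp H 2 μ, Integrable (fun t => Φ t (x t)) μ)
    (hcont : ∀ᵐ t ∂μ, Continuous (Φ t)) {U P : Lp H 2 μ}
    (hsub : ∀ x : Lp H 2 μ, (∫ t, Φ t (U t) ∂μ) + ⟪P, x - U⟫ ≤ ∫ t, Φ t (x t) ∂μ) :
    ∀ᵐ t ∂μ, ∀ y, Φ t (U t) + ⟪P t, y - U t⟫ ≤ Φ t y := by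
  have hP : Integrable P μ := (Lp.memLp P).integrable one_le_two
  have hz : ∀ z : H, ∀ᵐ t ∂μ, 0 ≤ Φ t (U t + z) - Φ t (U t) - ⟪z, P t⟫ := by
    intro z
    have hadd : (fun t => Φ t ((U + Lp.const 2 μ z : Lp H 2 μ) t)) =ᵐ[μ]
        fun t => Φ t (U t + z) := by
      filter_upwards [Lp.coeFn_add U (Lp.const 2 μ z), Lp.coeFn_const 2 μ z] with t h1 h2
      rw [h1, Pi.add_apply, h2]
      rfl
    have hI : Integrable (fun t => Φ t (U t + z) - Φ t (U t) - ⟪z, P t⟫) μ :=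
      (((hint _).congr hadd).sub (hint U)).sub (hP.const_inner z)
    refine ae_nonneg_of_forall_setIntegral_nonneg hI fun B hB hBfin => ?_
    -- Perturbing `U` by `z` on an arbitrary measurable set `B` localizes the inequality.
    have h1 := hsub (U + indicatorConstLp 2 hB hBfin.ne z)
    rw [add_sub_cancel_left, real_inner_comm, L2.inner_indicatorConstLp_eq_setIntegral_inner]
      at h1
    have h2 : (fun t => Φ t ((U + indicatorConstLp 2 hB hBfin.ne z : Lp H 2 μ) t)) =ᵐ[μ]
        fun t => Φ t (U t) + B.indicator (fun t => Φ t (U t + z) - Φ t (U t)) t := by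
      filter_upwards [Lp.coeFn_add U (indicatorConstLp 2 hB hBfin.ne z),
        indicatorConstLp_coeFn (p := 2) (hs := hB) (hμs := hBfin.ne) (c := z)] with t h3 h4
      rw [h3, Pi.add_apply, h4]
      by_cases ht : t ∈ B
      · simp [ht]
      · simp [ht]
    have h3 : Integrable (fun t => Φ t (U t + z) - Φ t (U t)) μ :=
      ((hint _).congr hadd).sub (hint U)
    rw [integral_congr_ae h2, integral_add (hint U) (h3.indicator hB),
      integral_indicator hB] at h1
    rw [integral_sub h3.integrableOn (hP.const_inner z).integrableOn]
    linarith
  have hall : ∀ᵐ t ∂μ, ∀ k : ℕ, 0 ≤ Φ t (U t + TopologicalSpace.denseSeq H k) - Φ t (U t) -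
      ⟪TopologicalSpace.denseSeq H k, P t⟫ := ae_all_iff.2 fun k => hz _
  filter_upwards [hall, hcont] with t h1 h2 y
  have hcl : IsClosed {z : H | 0 ≤ Φ t (U t + z) - Φ t (U t) - ⟪z, P t⟫} :=
    isClosed_le continuous_const (by fun_prop)
  have h3 : y - U t ∈ {z : H | 0 ≤ Φ t (U t + z) - Φ t (U t) - ⟪z, P t⟫} :=
    hcl.closure_subset_iff.2 (range_subset_iff.2 h1)
      ((TopologicalSpace.denseRange_denseSeq H).closure_range ▸ mem_univ _)
  rw [mem_ofPred_eq, add_sub_cancel, real_inner_comm] at h3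
  linarith

end Localization

/-! ### The functional twisted by `e^{ωt} S_t` -/

section Twist

variable {H : Type*} [NormedAddCommGroup H] [InnerProductSpace ℝ H]

theorem continuous_uncurry_of_isometry {R : ℝ → H ≃ₗᵢ[ℝ] H} (hR : ∀ x, Continuous fun t => R t x) :
    Continuous fun q : ℝ × H => R q.1 q.2 :=
  continuous_prod_of_continuous_lipschitzWith' _ 1 (fun t => (R t).lipschitz) hR

theorem aestronglyMeasurable_isometry_comp {R : ℝ → H ≃ₗᵢ[ℝ] H}
    (hR : ∀ x, Continuous fun t => R t x) {μ : Measure ℝ} {x : ℝ → H}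
    (hx : AEStronglyMeasurable x μ) : AEStronglyMeasurable (fun t => R t (x t)) μ :=
  (continuous_uncurry_of_isometry hR).comp_aestronglyMeasurable
    (aestronglyMeasurable_id.prodMk hx)

theorem aestronglyMeasurable_twist {R : ℝ → H ≃ₗᵢ[ℝ] H}
    (hR : ∀ x, Continuous fun t => R t x) (ω : ℝ) {μ : Measure ℝ} {x : ℝ → H}
    (hx : AEStronglyMeasurable x μ) :
    AEStronglyMeasurable (fun t => Real.exp (ω * t) • R t (x t)) μ :=
  (Continuous.aestronglyMeasurable (by fun_prop)).smul (aestronglyMeasurable_isometry_comp hR hx)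

theorem exists_twistLp {R : ℝ → H ≃ₗᵢ[ℝ] H} (hR : ∀ x, Continuous fun t => R t x) (ω T : ℝ)
    (x : Lp H 2 (volume.restrict (Icc 0 T))) :
    ∃ y : Lp H 2 (volume.restrict (Icc 0 T)),
      (y =ᵐ[volume.restrict (Icc 0 T)] fun t => Real.exp (ω * t) • R t (x t)) ∧
      ‖y‖ ≤ Real.exp (|ω| * T) * ‖x‖ ∧ ‖x‖ ≤ Real.exp (|ω| * T) * ‖y‖ := by
  have hm := aestronglyMeasurable_twist hR ω (Lp.aestronglyMeasurable x)
  have hb : ∀ᵐ t ∂(volume.restrict (Icc 0 T)),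
      ‖Real.exp (ω * t) • R t (x t)‖ ≤ Real.exp (|ω| * T) * ‖x t‖ := by
    filter_upwards [ae_restrict_mem measurableSet_Icc] with t ht
    rw [norm_smul, LinearIsometryEquiv.norm_map, Real.norm_eq_abs, Real.abs_exp]
    have : ω * t ≤ |ω| * T :=
      mul_le_mul (le_abs_self ω) ht.2 ht.1 (abs_nonneg ω)
    gcongr
  have hmem : MemLp (fun t => Real.exp (ω * t) • R t (x t)) 2 (volume.restrict (Icc 0 T)) :=
    (Lp.memLp x).of_le_mul hm hb
  refine ⟨hmem.toLp _, hmem.coeFn_toLp, Lp.norm_le_mul_norm_of_ae_le_mul ?_,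
    Lp.norm_le_mul_norm_of_ae_le_mul ?_⟩
  · filter_upwards [hmem.coeFn_toLp, hb] with t h1 h2
    rwa [h1]
  · filter_upwards [hmem.coeFn_toLp, ae_restrict_mem measurableSet_Icc] with t h1 ht
    rw [h1, norm_smul, LinearIsometryEquiv.norm_map, Real.norm_eq_abs, Real.abs_exp, ← mul_assoc,
      ← Real.exp_add]
    refine le_mul_of_one_le_left (norm_nonneg _) (Real.one_le_exp ?_)
    have h2 : -ω * t ≤ |ω| * T := mul_le_mul (neg_le_abs ω) ht.2 ht.1 (abs_nonneg ω)
    linarith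

theorem exp_weight_bounds {ω T t : ℝ} (ht : t ∈ Icc 0 T) :
    Real.exp (-2 * ω * t) ≤ Real.exp (2 * (|ω| * T)) ∧
      1 ≤ Real.exp (2 * (|ω| * T)) * Real.exp (-2 * ω * t) := by
  have h1 : ω * t ≤ |ω| * T := mul_le_mul (le_abs_self ω) ht.2 ht.1 (abs_nonneg ω)
  have h2 : -ω * t ≤ |ω| * T := mul_le_mul (neg_le_abs ω) ht.2 ht.1 (abs_nonneg ω)
  refine ⟨Real.exp_le_exp.2 (by linarith), ?_⟩
  rw [← Real.exp_add]
  exact Real.one_le_exp (by linarith)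

/-- The functional `∫₀ᵀ e^{-2ωt} N(t, e^{ωt} R_t x(t)) dt` on `L²(0, T; H)`. -/
def twistedIntegral (T ω : ℝ) (R : ℝ → H ≃ₗᵢ[ℝ] H) (N : ℝ → H → ℝ)
    (x : Lp H 2 (volume.restrict (Icc 0 T))) : ℝ :=
  ∫ t in Icc 0 T, Real.exp (-2 * ω * t) * N t (Real.exp (ω * t) • R t (x t))

variable {T ω : ℝ} {R : ℝ → H ≃ₗᵢ[ℝ] H} {N : ℝ → H → ℝ}

/-- With `y = e^{ωt} R_t x`, the norms of `x` and `y` are comparable up to `e^{|ω|T}` and the weight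
is comparable to `1` up to `e^{2|ω|T}`. Growth bounds therefore pass from `N` to the twisted
functional. -/
theorem twistedIntegral_bounds (hR : ∀ x, Continuous fun t => R t x)
    (hN0 : ∀ᵐ t ∂(volume.restrict (Icc 0 T)), ∀ y, 0 ≤ N t y)
    (hint : ∀ y : Lp H 2 (volume.restrict (Icc 0 T)),
      Integrable (fun t => N t (y t)) (volume.restrict (Icc 0 T)))
    (x : Lp H 2 (volume.restrict (Icc 0 T))) :
    Integrable (fun t => Real.exp (-2 * ω * t) * N t (Real.exp (ω * t) • R t (x t)))
      (volume.restrict (Icc 0 T)) ∧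
    ∃ y : Lp H 2 (volume.restrict (Icc 0 T)),
      ‖y‖ ≤ Real.exp (|ω| * T) * ‖x‖ ∧ ‖x‖ ≤ Real.exp (|ω| * T) * ‖y‖ ∧
      twistedIntegral T ω R N x ≤ Real.exp (2 * (|ω| * T)) * ∫ t in Icc 0 T, N t (y t) ∧
      ∫ t in Icc 0 T, N t (y t) ≤ Real.exp (2 * (|ω| * T)) * twistedIntegral T ω R N x := by
  obtain ⟨y, hy, hy1, hy2⟩ := exists_twistLp hR ω T x
  have hI : Integrable (fun t => N t (Real.exp (ω * t) • R t (x t)))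
      (volume.restrict (Icc 0 T)) := (hint y).congr (by
    filter_upwards [hy] with t ht
    rw [ht])
  have hI2 : Integrable (fun t => Real.exp (-2 * ω * t) * N t (Real.exp (ω * t) • R t (x t)))
      (volume.restrict (Icc 0 T)) := by
    refine Integrable.mono' (hI.norm.const_mul (Real.exp (2 * (|ω| * T))))
      ((Continuous.aestronglyMeasurable (by fun_prop)).mul hI.aestronglyMeasurable) ?_
    filter_upwards [ae_restrict_mem measurableSet_Icc] with t ht
    rw [norm_mul, Real.norm_eq_abs (Real.exp _), Real.abs_exp]
    exact mul_le_mul_of_nonneg_right (exp_weight_bounds ht).1 (norm_nonneg _)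
  refine ⟨hI2, y, hy1, hy2, ?_, ?_⟩
  · rw [twistedIntegral, ← integral_const_mul]
    refine integral_mono_ae hI2 ((hint y).const_mul _) ?_
    filter_upwards [hy, hN0, ae_restrict_mem measurableSet_Icc] with t h1 h2 ht
    rw [h1]
    exact mul_le_mul_of_nonneg_right (exp_weight_bounds ht).1 (h2 _)
  · rw [twistedIntegral, ← integral_const_mul]
    refine integral_mono_ae (hint y) (hI2.const_mul _) ?_
    filter_upwards [hy, hN0, ae_restrict_mem measurableSet_Icc] with t h1 h2 ht
    rw [h1, ← mul_assoc]
    exact le_mul_of_one_le_left (h2 _) (exp_weight_bounds ht).2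

theorem twistedIntegral_nonneg
    (hN0 : ∀ᵐ t ∂(volume.restrict (Icc 0 T)), ∀ y, 0 ≤ N t y)
    (x : Lp H 2 (volume.restrict (Icc 0 T))) : 0 ≤ twistedIntegral T ω R N x := by
  refine integral_nonneg_of_ae ?_
  filter_upwards [hN0] with t ht
  exact mul_nonneg (Real.exp_nonneg _) (ht _)

theorem convexOn_twistedIntegral (hR : ∀ x, Continuous fun t => R t x)
    (hN0 : ∀ᵐ t ∂(volume.restrict (Icc 0 T)), ∀ y, 0 ≤ N t y)
    (hconv : ∀ᵐ t ∂(volume.restrict (Icc 0 T)), ConvexOn ℝ univ (N t))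
    (hint : ∀ y : Lp H 2 (volume.restrict (Icc 0 T)),
      Integrable (fun t => N t (y t)) (volume.restrict (Icc 0 T))) :
    ConvexOn ℝ univ (twistedIntegral T ω R N) := by
  have hI := fun x => (twistedIntegral_bounds (ω := ω) hR hN0 hint x).1
  refine ⟨convex_univ, fun x _ y _ a b ha hb hab => ?_⟩
  simp only [smul_eq_mul, twistedIntegral]
  rw [← integral_const_mul, ← integral_const_mul,
    ← integral_add ((hI x).const_mul a) ((hI y).const_mul b)]
  refine integral_mono_ae (hI _) (((hI x).const_mul a).add ((hI y).const_mul b)) ?_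
  filter_upwards [hconv, Lp.coeFn_add (a • x) (b • y), Lp.coeFn_smul a x, Lp.coeFn_smul b y]
    with t h1 h2 h3 h4
  have h5 := h1.2 (mem_univ (Real.exp (ω * t) • R t (x t)))
    (mem_univ (Real.exp (ω * t) • R t (y t))) ha hb hab
  have h6 : Real.exp (ω * t) • R t ((a • x + b • y : Lp H 2 (volume.restrict (Icc 0 T))) t) =
      a • Real.exp (ω * t) • R t (x t) + b • Real.exp (ω * t) • R t (y t) := by
    rw [h2, Pi.add_apply, h3, h4, Pi.smul_apply, Pi.smul_apply, map_add, map_smul, map_smul,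
      smul_add, smul_comm a, smul_comm b]
  rw [h6]
  have h7 := mul_le_mul_of_nonneg_left h5 (Real.exp_nonneg (-2 * ω * t))
  simp only [smul_eq_mul] at h7
  linarith

theorem continuous_twistedIntegral (hR : ∀ x, Continuous fun t => R t x)
    (hN0 : ∀ᵐ t ∂(volume.restrict (Icc 0 T)), ∀ y, 0 ≤ N t y)
    (hconv : ∀ᵐ t ∂(volume.restrict (Icc 0 T)), ConvexOn ℝ univ (N t))
    (hint : ∀ y : Lp H 2 (volume.restrict (Icc 0 T)),
      Integrable (fun t => N t (y t)) (volume.restrict (Icc 0 T)))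
    {n C : ℝ} (hn : 0 ≤ n) (hC : 0 ≤ C)
    (hupper : ∀ y : Lp H 2 (volume.restrict (Icc 0 T)),
      ∫ t in Icc 0 T, N t (y t) ≤ C * (1 + ‖y‖ ^ n)) :
    Continuous (twistedIntegral T ω R N) := by
  have hF := convexOn_twistedIntegral (ω := ω) hR hN0 hconv hint
  suffices h : ∃ x₀ ∈ (univ : Set (Lp H 2 (volume.restrict (Icc 0 T)))),
      (𝓝 x₀).IsBoundedUnder (· ≤ ·) (twistedIntegral T ω R N) from
    continuousOn_univ.1 (((hF.continuousOn_tfae isOpen_univ univ_nonempty).out 3 1).1 h)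
  refine ⟨0, mem_univ _, Real.exp (2 * (|ω| * T)) * (C * (1 + Real.exp (|ω| * T) ^ n)), ?_⟩
  rw [eventually_map]
  filter_upwards [Metric.ball_mem_nhds (0 : Lp H 2 (volume.restrict (Icc 0 T))) one_pos] with x hx
  obtain ⟨-, y, h1, -, h3, -⟩ := twistedIntegral_bounds (ω := ω) hR hN0 hint x
  have h4 : ‖y‖ ≤ Real.exp (|ω| * T) := by
    rw [mem_ball_zero_iff] at hx
    exact h1.trans (mul_le_of_le_one_right (Real.exp_nonneg _) hx.le)
  refine h3.trans ?_
  have h5 := hupper y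
  have h6 : ‖y‖ ^ n ≤ Real.exp (|ω| * T) ^ n := Real.rpow_le_rpow (norm_nonneg _) h4 hn
  have h7 : C * (1 + ‖y‖ ^ n) ≤ C * (1 + Real.exp (|ω| * T) ^ n) := by gcongr
  have := h5.trans h7
  gcongr

theorem coercive_twistedIntegral (hR : ∀ x, Continuous fun t => R t x)
    (hN0 : ∀ᵐ t ∂(volume.restrict (Icc 0 T)), ∀ y, 0 ≤ N t y)
    (hint : ∀ y : Lp H 2 (volume.restrict (Icc 0 T)),
      Integrable (fun t => N t (y t)) (volume.restrict (Icc 0 T)))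
    {m C : ℝ} (hm : 1 ≤ m) (hC : 0 < C)
    (hlower : ∀ y : Lp H 2 (volume.restrict (Icc 0 T)),
      C * (‖y‖ ^ m - 1) ≤ ∫ t in Icc 0 T, N t (y t)) (r : ℝ) :
    ∃ ρ, ∀ x, twistedIntegral T ω R N x ≤ r → ‖x‖ ≤ ρ := by
  -- The `max` with `1` disposes of `‖y‖ ≤ 1`; beyond it `‖y‖ ≤ ‖y‖ ^ m`.
  refine ⟨Real.exp (|ω| * T) * max 1 (Real.exp (2 * (|ω| * T)) * r / C + 1), fun x hx => ?_⟩
  obtain ⟨-, y, -, h2, -, h4⟩ := twistedIntegral_bounds (ω := ω) hR hN0 hint x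
  refine h2.trans (mul_le_mul_of_nonneg_left ?_ (Real.exp_nonneg _))
  rcases le_total ‖y‖ 1 with h | h
  · exact h.trans (le_max_left _ _)
  · refine le_trans ?_ (le_max_right _ _)
    have h5 := Real.self_le_rpow_of_one_le h hm
    have h6 : C * (‖y‖ ^ m - 1) ≤ Real.exp (2 * (|ω| * T)) * r :=
      (hlower y).trans (h4.trans (mul_le_mul_of_nonneg_left hx (Real.exp_nonneg _)))
    have h7 : ‖y‖ ^ m - 1 ≤ Real.exp (2 * (|ω| * T)) * r / C := by
      rw [le_div_iff₀ hC]
      linarith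
    linarith

end Twist

/-! ### Fenchel-Young, normalization of `φ`, and arcs -/

section IntegrandEstimates

local notation "⟪" x ", " y "⟫" => inner ℝ x y

variable {H : Type*} [NormedAddCommGroup H] [InnerProductSpace ℝ H]

theorem conjugate_ne_bot {f : H → EReal} {x : H} (hx : f x ≠ ⊤) (p : H) :
    conjugate ℝ f p ≠ ⊥ := by
  intro h
  have h1 : ((⟪x, p⟫ : ℝ) : EReal) - f x ≤ ⊥ :=
    h ▸ le_iSup (fun x : H => ((⟪x, p⟫ : ℝ) : EReal) - f x) x
  rw [le_bot_iff] at h1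
  induction hfx : f x with
  | bot => simp [hfx] at h1
  | top => exact hx hfx
  | coe a =>
    rw [hfx, ← EReal.coe_sub] at h1
    exact EReal.coe_ne_bot _ h1

/-- Fenchel-Young inequality. -/
theorem inner_le_add_conjugate {f : H → EReal} (hbot : ∀ x, f x ≠ ⊥) {x₀ : H} (hx₀ : f x₀ ≠ ⊤)
    (x p : H) : ((⟪x, p⟫ : ℝ) : EReal) ≤ f x + conjugate ℝ f p := by
  induction hfx : f x with
  | bot => exact absurd hfx (hbot x)
  | top =>
    rw [EReal.top_add_of_ne_bot (conjugate_ne_bot hx₀ p)]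
    exact le_top
  | coe a =>
    have h1 : ((⟪x, p⟫ : ℝ) : EReal) - f x ≤ conjugate ℝ f p :=
      le_iSup (fun x : H => ((⟪x, p⟫ : ℝ) : EReal) - f x) x
    rw [hfx] at h1
    calc ((⟪x, p⟫ : ℝ) : EReal) = (a : EReal) + (((⟪x, p⟫ : ℝ) : EReal) - a) := by
          rw [← EReal.coe_sub, ← EReal.coe_add, add_sub_cancel]
      _ ≤ _ := by gcongr

theorem coe_mul_le_coe_mul_add {c a b : ℝ} {k : EReal} (hc : 0 < c)
    (h : ((b - a : ℝ) : EReal) ≤ k) :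
    ((c * b : ℝ) : EReal) ≤ (c : EReal) * ((a : EReal) + k) := by
  induction k with
  | bot => exact absurd (le_bot_iff.1 h) (EReal.coe_ne_bot _)
  | top =>
    rw [EReal.coe_add_top, EReal.coe_mul_top_of_pos hc]
    exact le_top
  | coe k =>
    rw [← EReal.coe_add, ← EReal.coe_mul, EReal.coe_le_coe_iff]
    have := EReal.coe_le_coe_iff.1 h
    exact mul_le_mul_of_nonneg_left (by linarith) hc.le

theorem coe_mul_eq_coe_mul_add_iff {c a b : ℝ} {k : EReal} (hc : 0 < c) :
    (c : EReal) * ((a : EReal) + k) = ((c * b : ℝ) : EReal) ↔ k = ((b - a : ℝ) : EReal) := by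
  induction k with
  | bot => simp [EReal.coe_mul_bot_of_pos hc, -EReal.coe_mul, -EReal.coe_sub]
  | top => simp [EReal.coe_mul_top_of_pos hc, -EReal.coe_mul, -EReal.coe_sub]
  | coe k =>
    rw [← EReal.coe_add, ← EReal.coe_mul, EReal.coe_eq_coe_iff, EReal.coe_eq_coe_iff,
      mul_right_inj' hc.ne']
    constructor <;> intro h <;> linarith

theorem inner_twist (R : ℝ → H ≃ₗᵢ[ℝ] H) (ω t : ℝ) (x y : H) :
    ⟪Real.exp (ω * t) • R t x, -(Real.exp (ω * t) • R t y)⟫ =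
      Real.exp (ω * t) * (Real.exp (ω * t) * -⟪x, y⟫) := by
  rw [inner_neg_right, real_inner_smul_left, real_inner_smul_right, LinearIsometryEquiv.inner_map_map]
  ring

theorem exp_weight_mul (ω t r : ℝ) :
    Real.exp (-2 * ω * t) * (Real.exp (ω * t) * (Real.exp (ω * t) * r)) = r := by
  rw [← mul_assoc, ← mul_assoc, ← Real.exp_add, ← Real.exp_add]
  simp only [show -2 * ω * t + ω * t + ω * t = 0 by ring, Real.exp_zero, one_mul]

/-- Take `κ t = φ*(t, 0) = -inf φ(t, ·)`. The upper growth bound at `x = 0` makes it finite a.e., so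
the extended integral becomes an ordinary integral of a nonnegative function. -/
theorem exists_normalization_of_growth {T : ℝ} [TopologicalSpace.SeparableSpace H] {φ : ℝ → H → ℝ}
    (hφmeas : ∀ x, AEMeasurable (fun t => φ t x) (volume.restrict (Icc 0 T)))
    (hφcont : ∀ t ∈ Icc 0 T, Continuous (φ t)) {C : Lp H 2 (volume.restrict (Icc 0 T)) → ℝ}
    (hC : ∀ x : Lp H 2 (volume.restrict (Icc 0 T)),
      extIntegral (volume.restrict (Icc 0 T)) (fun t => ((φ t (x t) : ℝ) : EReal) +
        conjugate ℝ (fun y => ((φ t y : ℝ) : EReal)) 0) ≤ ((C x : ℝ) : EReal)) :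
    ∃ κ : ℝ → ℝ, (∀ᵐ t ∂(volume.restrict (Icc 0 T)), ∀ y, 0 ≤ φ t y + κ t) ∧
      ∀ x : Lp H 2 (volume.restrict (Icc 0 T)),
        Integrable (fun t => φ t (x t) + κ t) (volume.restrict (Icc 0 T)) ∧
        extIntegral (volume.restrict (Icc 0 T)) (fun t => ((φ t (x t) : ℝ) : EReal) +
          conjugate ℝ (fun y => ((φ t y : ℝ) : EReal)) 0) =
          ((∫ t in Icc 0 T, (φ t (x t) + κ t) : ℝ) : EReal) := by
  have hcont : ∀ᵐ t ∂(volume.restrict (Icc 0 T)), Continuous (φ t) := by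
    filter_upwards [ae_restrict_mem measurableSet_Icc] with t ht using hφcont t ht
  have hconj : AEMeasurable (fun t => conjugate ℝ (fun y => ((φ t y : ℝ) : EReal)) 0)
      (volume.restrict (Icc 0 T)) :=
    aemeasurable_conjugate hφmeas hcont aestronglyMeasurable_const
  have hm : ∀ x : Lp H 2 (volume.restrict (Icc 0 T)),
      AEMeasurable (fun t => φ t (x t)) (volume.restrict (Icc 0 T)) := fun x =>
    aemeasurable_caratheodory hφmeas hcont (Lp.aestronglyMeasurable x)
  have hle : ∀ t y, ((-φ t y : ℝ) : EReal) ≤ conjugate ℝ (fun y => ((φ t y : ℝ) : EReal)) 0 := by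
    intro t y
    simpa only [inner_zero_right, zero_sub] using sub_le_conjugate (φ t) y 0
  have hnn : ∀ t y, 0 ≤ ((φ t y : ℝ) : EReal) +
      conjugate ℝ (fun y => ((φ t y : ℝ) : EReal)) 0 := by
    intro t y
    have h1 := coe_mul_le_coe_mul_add (c := 1) (a := φ t y) (b := 0)
      (k := conjugate ℝ (fun y => ((φ t y : ℝ) : EReal)) 0) one_pos (by rw [zero_sub]; exact hle t y)
    simpa using h1
  have hfin : ∀ x : Lp H 2 (volume.restrict (Icc 0 T)),
      ∫⁻ t in Icc 0 T, (((φ t (x t) : ℝ) : EReal) +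
        conjugate ℝ (fun y => ((φ t y : ℝ) : EReal)) 0).toENNReal ≠ ⊤ := by
    intro x h
    have h1 := hC x
    rw [extIntegral_of_nonneg (.of_forall fun t => hnn t _), h] at h1
    exact absurd h1 (by simp)
  have hnetop : ∀ᵐ t ∂(volume.restrict (Icc 0 T)),
      conjugate ℝ (fun y => ((φ t y : ℝ) : EReal)) 0 ≠ ⊤ := by
    have h1 := ae_lt_top' (((hm 0).coe_real_ereal.add hconj).ereal_toENNReal) (hfin 0)
    filter_upwards [h1] with t ht htop
    simp [htop] at ht
  have heq : ∀ᵐ t ∂(volume.restrict (Icc 0 T)), conjugate ℝ (fun y => ((φ t y : ℝ) : EReal)) 0 =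
      (((conjugate ℝ (fun y => ((φ t y : ℝ) : EReal)) 0).toReal : ℝ) : EReal) := by
    filter_upwards [hnetop] with t ht
    exact (EReal.coe_toReal ht (conjugate_ne_bot (f := fun y => ((φ t y : ℝ) : EReal)) (x := 0) (EReal.coe_ne_top _) _)).symm
  refine ⟨fun t => (conjugate ℝ (fun y => ((φ t y : ℝ) : EReal)) 0).toReal, ?_, fun x => ?_⟩
  · filter_upwards [heq] with t ht y
    have := hnn t y
    rw [ht] at this
    exact_mod_cast this
  · have h1 : (fun t => ((φ t (x t) : ℝ) : EReal) +
        conjugate ℝ (fun y => ((φ t y : ℝ) : EReal)) 0) =ᵐ[volume.restrict (Icc 0 T)]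
        fun t => ((φ t (x t) + (conjugate ℝ (fun y => ((φ t y : ℝ) : EReal)) 0).toReal : ℝ) :
          EReal) := by
      filter_upwards [heq] with t ht
      rw [EReal.coe_add, ← ht]
    have h2 : Integrable
        (fun t => φ t (x t) + (conjugate ℝ (fun y => ((φ t y : ℝ) : EReal)) 0).toReal)
        (volume.restrict (Icc 0 T)) := by
      refine ⟨((hm x).add hconj.ereal_toReal).aestronglyMeasurable, ?_⟩
      rw [hasFiniteIntegral_iff_ofReal]
      · refine lt_of_eq_of_lt (lintegral_congr_ae ?_) (lt_top_iff_ne_top.2 (hfin x))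
        filter_upwards [h1] with t ht
        rw [ht, EReal.real_coe_toENNReal]
      · filter_upwards [h1] with t ht
        have := hnn t (x t)
        rw [ht] at this
        exact_mod_cast this
    exact ⟨h2, (extIntegral_congr h1).trans (extIntegral_coe h2)⟩

section PathSpace

variable {T : ℝ}

theorem mem_pathSpace_of_primitive [CompleteSpace H] (hT : 0 ≤ T) {u u' : ℝ → H}
    (hu' : MemLp u' 2 (volume.restrict (Icc 0 T)))
    (hu : ∀ t, u t = u 0 + ∫ s in (0 : ℝ)..t, u' s) :
    deriv u =ᵐ[volume.restrict (Icc 0 T)] u' ∧ u ∈ pathSpace T := by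
  have h1 : deriv u =ᵐ[volume.restrict (Icc 0 T)] u' := by
    have hI := intervalIntegrable_of_memLp hT hu'
    refine (ae_restrict_iff' measurableSet_Icc).2 ?_
    filter_upwards [hI.ae_hasDerivAt_integral] with t h2 ht
    rw [uIcc_of_le hT] at h2
    have h3 := (h2 ht 0 ⟨le_rfl, hT⟩).const_add (u 0)
    rw [← funext hu] at h3
    exact h3.deriv
  refine ⟨h1, (memLp_congr_ae h1).2 hu', fun t ht => ?_⟩
  rw [intervalIntegral_congr_of_ae ht h1]
  exact hu t

theorem pathSpace_continuousOn (hT : 0 ≤ T) {u : ℝ → H} (hu : u ∈ pathSpace T) :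
    ContinuousOn u (Icc 0 T) :=
  (continuousOn_primitive hT (intervalIntegrable_of_memLp hT hu.1) (u 0)).congr hu.2

theorem pathSpace_integral_inner [CompleteSpace H] (hT : 0 ≤ T) {u : ℝ → H}
    (hu : u ∈ pathSpace T) :
    Integrable (fun t => -⟪u t, deriv u t⟫) (volume.restrict (Icc 0 T)) ∧
    ∫ t in Icc 0 T, -⟪u t, deriv u t⟫ = -⟪u 0 - u T, -((1 / 2 : ℝ) • (u 0 + u T))⟫ := by
  have hI := intervalIntegrable_of_memLp hT hu.1
  obtain ⟨h1, h2, h3⟩ := integral_inner_eq_sub hT hI hI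
    (u := fun t => u 0 + ∫ s in (0 : ℝ)..t, deriv u s)
    (w := fun t => u 0 + ∫ s in (0 : ℝ)..t, deriv u s) (fun _ => rfl) (fun _ => rfl)
  have e1 : (fun t => ⟪u 0 + ∫ s in (0 : ℝ)..t, deriv u s, deriv u t⟫)
      =ᵐ[volume.restrict (Icc 0 T)] fun t => ⟪u t, deriv u t⟫ := by
    filter_upwards [ae_restrict_mem measurableSet_Icc] with t ht
    rw [← hu.2 t ht]
  have e2 : (fun t => ⟪deriv u t, u 0 + ∫ s in (0 : ℝ)..t, deriv u s⟫)
      =ᵐ[volume.restrict (Icc 0 T)] fun t => ⟪u t, deriv u t⟫ := by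
    filter_upwards [ae_restrict_mem measurableSet_Icc] with t ht
    rw [← hu.2 t ht, real_inner_comm]
  refine ⟨(h1.congr e1).neg, ?_⟩
  rw [integral_congr_ae e1, integral_congr_ae e2] at h3
  simp only [← hu.2 T ⟨hT, le_rfl⟩, intervalIntegral.integral_same, add_zero] at h3
  rw [integral_neg]
  simp only [inner_neg_right, real_inner_smul_right, inner_sub_left, inner_add_right]
  have h4 := real_inner_comm (u 0) (u T)
  linarith

/-- Put `z = e^{ωt} u`. The hypothesis reads `F - ω v = -S_s z'`, so `S (t - s)` turns the integrand
into `-S_t z'` with `S_t` fixed. The mild formula is then `S_t` applied to the fundamental theorem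
for `z`. -/
theorem isMildSolution_of_ae [CompleteSpace H] (hT : 0 ≤ T) {ω : ℝ} {S : ℝ → H ≃ₗᵢ[ℝ] H}
    (hS : IsC0UnitaryGroup S) {F : ℝ → H → H} {u v : ℝ → H} (hu : u ∈ pathSpace T)
    (hv : ∀ t, v t = S t (Real.exp (ω * t) • u t))
    (hF : ∀ᵐ t ∂(volume.restrict (Icc 0 T)),
      F t (v t) = -(Real.exp (ω * t) • S t (deriv u t))) : IsMildSolution T ω S F v := by
  have huc := pathSpace_continuousOn hT hu
  have h0 : (0 : ℝ) ∈ Icc 0 T := ⟨le_rfl, hT⟩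
  have hI := intervalIntegrable_of_memLp hT hu.1
  set B := ContinuousLinearMap.lsmul ℝ ℝ (E := H)
  have hexp : ∀ t, Real.exp (ω * t) = 1 + ∫ s in (0 : ℝ)..t, Real.exp (ω * s) * ω := by
    intro t
    rw [intervalIntegral.integral_eq_sub_of_hasDerivAt (f := fun s => Real.exp (ω * s))
      (fun s _ => by simpa using ((hasDerivAt_id s).const_mul ω).exp)
      (Continuous.intervalIntegrable (by fun_prop) _ _)]
    simp
  have hexpI : IntervalIntegrable (fun s => Real.exp (ω * s) * ω) volume 0 T :=
    Continuous.intervalIntegrable (by fun_prop) _ _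
  set z' : ℝ → H := fun s => Real.exp (ω * s) • deriv u s + (Real.exp (ω * s) * ω) • u s with hz'
  have hz'I : IntervalIntegrable z' volume 0 T :=
    (intervalIntegrable_bilin hT B (u := fun s => Real.exp (ω * s))
      (Continuous.continuousOn (by fun_prop)) hI).add
      (intervalIntegrable_bilin hT B.flip huc hexpI)
  have hz : ∀ t ∈ Icc 0 T, Real.exp (ω * t) • u t - u 0 = ∫ s in (0 : ℝ)..t, z' s := by
    intro t ht
    have h1 := bilin_sub_eq_integral hT B hexpI hI (u := fun s => Real.exp (ω * s))
      (w := fun t => u 0 + ∫ s in (0 : ℝ)..t, deriv u s) hexp (fun _ => rfl) t ht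
    simp only [B, ContinuousLinearMap.lsmul_apply, intervalIntegral.integral_same, add_zero,
      mul_zero, Real.exp_zero, one_smul, ← hu.2 t ht] at h1
    rw [h1]
    apply intervalIntegral.integral_congr
    intro s hs
    rw [uIcc_of_le ht.1] at hs
    simp only [hz', ← hu.2 s ⟨hs.1, hs.2.trans ht.2⟩]
  refine ⟨?_, fun t ht => ?_⟩
  · rw [funext hv]
    refine (continuous_uncurry_of_isometry hS.continuous).comp_continuousOn
      (f := fun t => (t, Real.exp (ω * t) • u t)) ?_
    exact continuousOn_id.prodMk ((Continuous.continuousOn (by fun_prop)).smul huc)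
  · set L : H →L[ℝ] H := ((S t).toContinuousLinearEquiv : H →L[ℝ] H)
    have hL : ∀ x, L x = S t x := fun _ => rfl
    have hz't := intervalIntegrable_of_mem_Icc hz'I h0 ht
    have heq : (fun s => S (t - s) (F s (v s) - ω • v s)) =ᵐ[volume.restrict (Icc 0 T)]
        fun s => -(L (z' s)) := by
      filter_upwards [hF] with s hs
      have h1 : F s (v s) - ω • v s = -(S s (z' s)) := by
        rw [hs, hv]
        simp only [hz', map_add, map_smul]
        module
      rw [h1, map_neg, ← hS.add, sub_add_cancel, hL]
    have hLI : IntervalIntegrable (fun s => -(L (z' s))) volume 0 t :=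
      IntervalIntegrable.neg ⟨L.integrable_comp hz't.1, L.integrable_comp hz't.2⟩
    constructor
    · refine hLI.congr_ae ?_
      refine ae_restrict_of_ae_restrict_of_subset ?_ heq.symm
      rw [uIoc_of_le ht.1]
      exact fun s hs => ⟨hs.1.le, hs.2.trans ht.2⟩
    · rw [intervalIntegral_congr_of_ae ht heq, intervalIntegral.integral_neg,
        L.intervalIntegral_comp_comm hz't, ← hz t ht, hL, hv t, hv 0, hS.zero]
      simp only [mul_zero, Real.exp_zero, one_smul, map_sub]
      abel

end PathSpace

end IntegrandEstimates

/-! ### Nonnegativity of the functional, its zeros, and their existence -/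

section SelfdualPrinciple

local notation "⟪" x ", " y "⟫" => inner ℝ x y

variable {H : Type*} [NormedAddCommGroup H] [InnerProductSpace ℝ H]

/-- The integrand of the selfdual functional. -/
def selfdualIntegrand (ω : ℝ) (S : ℝ → H ≃ₗᵢ[ℝ] H) (φ : ℝ → H → ℝ) (u : ℝ → H) (t : ℝ) : EReal :=
  ((Real.exp (-2 * ω * t) : ℝ) : EReal) *
    (((φ t (Real.exp (ω * t) • S t (u t)) : ℝ) : EReal) +
      conjugate ℝ (fun y => ((φ t y : ℝ) : EReal)) (-(Real.exp (ω * t) • S t (deriv u t))))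

theorem neg_inner_le_selfdualIntegrand (ω : ℝ) (S : ℝ → H ≃ₗᵢ[ℝ] H) (φ : ℝ → H → ℝ) (u : ℝ → H)
    (t : ℝ) : ((-⟪u t, deriv u t⟫ : ℝ) : EReal) ≤ selfdualIntegrand ω S φ u t := by
  have h := coe_mul_le_coe_mul_add (Real.exp_pos (-2 * ω * t))
    (sub_le_conjugate (φ t) (Real.exp (ω * t) • S t (u t))
      (-(Real.exp (ω * t) • S t (deriv u t))))
  rwa [inner_twist, exp_weight_mul] at h

/-- The lower bound of the integrand is attained exactly when Fenchel-Young is an equality at time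
`t`. -/
theorem selfdualIntegrand_eq_iff (ω : ℝ) (S : ℝ → H ≃ₗᵢ[ℝ] H) (φ : ℝ → H → ℝ) (u : ℝ → H)
    (t : ℝ) : selfdualIntegrand ω S φ u t = ((-⟪u t, deriv u t⟫ : ℝ) : EReal) ↔
      conjugate ℝ (fun y => ((φ t y : ℝ) : EReal)) (-(Real.exp (ω * t) • S t (deriv u t))) =
        ((⟪Real.exp (ω * t) • S t (u t), -(Real.exp (ω * t) • S t (deriv u t))⟫ -
          φ t (Real.exp (ω * t) • S t (u t)) : ℝ) : EReal) := by
  rw [← coe_mul_eq_coe_mul_add_iff (Real.exp_pos (-2 * ω * t)), inner_twist, exp_weight_mul]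
  rfl

variable [CompleteSpace H] [TopologicalSpace.SeparableSpace H] {S : ℝ → H ≃ₗᵢ[ℝ] H}
  {T ω : ℝ} {φ : ℝ → H → ℝ} {ψ : H → EReal}

theorem aemeasurable_selfdualIntegrand (hS : IsC0UnitaryGroup S)
    (hφmeas : ∀ x, AEMeasurable (fun t => φ t x) (volume.restrict (Icc 0 T)))
    (hφcont : ∀ t ∈ Icc 0 T, Continuous (φ t)) {u : ℝ → H} (hT : 0 ≤ T) (hu : u ∈ pathSpace T) :
    AEMeasurable (selfdualIntegrand ω S φ u) (volume.restrict (Icc 0 T)) := by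
  have hcont : ∀ᵐ t ∂(volume.restrict (Icc 0 T)), Continuous (φ t) := by
    filter_upwards [ae_restrict_mem measurableSet_Icc] with t ht using hφcont t ht
  refine AEMeasurable.mul (Measurable.aemeasurable (by fun_prop)) ?_
  refine (aemeasurable_caratheodory hφmeas hcont (aestronglyMeasurable_twist hS.continuous ω
    ((pathSpace_continuousOn hT hu).aestronglyMeasurable measurableSet_Icc))).coe_real_ereal.add
    (aemeasurable_conjugate hφmeas hcont
      (aestronglyMeasurable_twist hS.continuous ω hu.1.aestronglyMeasurable).neg)

omit [CompleteSpace H] [TopologicalSpace.SeparableSpace H] in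
theorem selfdualFunctional_eq (u : ℝ → H) :
    selfdualFunctional T ω S φ ψ u =
      extIntegral (volume.restrict (Icc 0 T)) (selfdualIntegrand ω S φ u) +
        (ψ (u 0 - u T) + conjugate ℝ ψ (-((1 / 2 : ℝ) • (u 0 + u T)))) :=
  add_assoc _ _ _

omit [TopologicalSpace.SeparableSpace H] in
theorem neg_inner_le_extIntegral (hT : 0 ≤ T) {u : ℝ → H} (hu : u ∈ pathSpace T) :
    ((-⟪u 0 - u T, -((1 / 2 : ℝ) • (u 0 + u T))⟫ : ℝ) : EReal) ≤
      extIntegral (volume.restrict (Icc 0 T)) (selfdualIntegrand ω S φ u) := by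
  obtain ⟨h1, h2⟩ := pathSpace_integral_inner hT hu
  rw [← h2]
  exact coe_integral_le_extIntegral h1
    (.of_forall fun t => neg_inner_le_selfdualIntegrand ω S φ u t)

omit [TopologicalSpace.SeparableSpace H] in
theorem selfdualFunctional_nonneg (hT : 0 ≤ T) (hψbot : ∀ x, ψ x ≠ ⊥) (hψ0 : ψ 0 ≠ ⊤)
    {u : ℝ → H} (hu : u ∈ pathSpace T) : 0 ≤ selfdualFunctional T ω S φ ψ u := by
  rw [selfdualFunctional_eq]
  refine le_trans ?_ (add_le_add (neg_inner_le_extIntegral hT hu)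
    (inner_le_add_conjugate hψbot hψ0 _ _))
  rw [← EReal.coe_add, neg_add_cancel, EReal.coe_zero]

theorem eq_of_add_eq_zero_of_le {x y : EReal} {b : ℝ} (hx : ((-b : ℝ) : EReal) ≤ x)
    (hy : (b : EReal) ≤ y) (h : x + y = 0) : x = ((-b : ℝ) : EReal) ∧ y = (b : EReal) := by
  induction x with
  | bot => exact absurd (le_bot_iff.1 hx) (EReal.coe_ne_bot _)
  | top =>
    rw [EReal.top_add_of_ne_bot (ne_bot_of_le_ne_bot (EReal.coe_ne_bot b) hy)] at h
    exact absurd h EReal.top_ne_zero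
  | coe x =>
    induction y with
    | bot => exact absurd (le_bot_iff.1 hy) (EReal.coe_ne_bot _)
    | top => simp at h
    | coe y =>
      have h1 := EReal.coe_le_coe_iff.1 hx
      have h2 := EReal.coe_le_coe_iff.1 hy
      have h3 : x + y = 0 := by exact_mod_cast h
      rw [EReal.coe_eq_coe_iff, EReal.coe_eq_coe_iff]
      constructor <;> linarith

omit [CompleteSpace H] [TopologicalSpace.SeparableSpace H] in
theorem mem_subdifferential_of_add_conjugate_le (hψbot : ∀ x, ψ x ≠ ⊥) {x₀ : H} (hψ0 : ψ x₀ ≠ ⊤)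
    {d s : H} (h : ψ d + conjugate ℝ ψ s ≤ ((⟪d, s⟫ : ℝ) : EReal)) :
    s ∈ subdifferential ℝ ψ d := by
  have hbot := conjugate_ne_bot hψ0 s
  have hd : ψ d ≠ ⊤ := by
    intro hd
    rw [hd, EReal.top_add_of_ne_bot hbot, top_le_iff] at h
    exact EReal.coe_ne_top _ h
  refine ⟨hd, fun y => ?_⟩
  have hre : (RCLike.re (inner ℝ s (y - d)) : ℝ) = ⟪y, s⟫ - ⟪d, s⟫ := by
    change ⟪s, y - d⟫ = _
    rw [inner_sub_right, real_inner_comm, real_inner_comm d]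
  rw [hre]
  have h1 := inner_le_add_conjugate hψbot hψ0 y s
  induction hy : ψ y with
  | bot => exact absurd hy (hψbot y)
  | top => exact le_top
  | coe r =>
    rw [hy] at h1
    generalize conjugate ℝ ψ s = k at *
    induction hd' : ψ d with
    | bot => exact absurd hd' (hψbot d)
    | top => exact absurd hd' hd
    | coe a =>
      rw [hd'] at h
      induction k with
      | bot => exact absurd rfl hbot
      | top => simp at h
      | coe k =>
        norm_cast at h h1 ⊢
        linarith

theorem ae_grad_of_selfdualFunctional_eq_zero (hT : 0 ≤ T) (hS : IsC0UnitaryGroup S)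
    {dφ : ℝ → H → H}
    (hφmeas : ∀ x, AEMeasurable (fun t => φ t x) (volume.restrict (Icc 0 T)))
    (hφconv : ∀ t ∈ Icc 0 T, ConvexOn ℝ univ (φ t))
    (hφdiff : ∀ t ∈ Icc 0 T, ∀ x, HasGateauxGradientAt ℝ (φ t) (dφ t x) x)
    (hψbot : ∀ x, ψ x ≠ ⊥) (hψ0 : ψ 0 ≠ ⊤) {u : ℝ → H} (hu : u ∈ pathSpace T)
    (h0 : selfdualFunctional T ω S φ ψ u = 0) :
    (∀ᵐ t ∂(volume.restrict (Icc 0 T)), dφ t (Real.exp (ω * t) • S t (u t)) =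
      -(Real.exp (ω * t) • S t (deriv u t))) ∧
    -((1 / 2 : ℝ) • (u 0 + u T)) ∈ subdifferential ℝ ψ (u 0 - u T) := by
  have hφcont : ∀ t ∈ Icc 0 T, Continuous (φ t) := fun t ht =>
    continuous_of_hasGateauxGradientAt (hφconv t ht) (hφdiff t ht)
  rw [selfdualFunctional_eq] at h0
  obtain ⟨h1, h2⟩ := eq_of_add_eq_zero_of_le (neg_inner_le_extIntegral hT hu)
    (inner_le_add_conjugate hψbot hψ0 _ _) h0
  refine ⟨?_, mem_subdifferential_of_add_conjugate_le hψbot hψ0 h2.le⟩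
  obtain ⟨h3, h4⟩ := pathSpace_integral_inner hT hu
  have h5 := ae_eq_of_extIntegral_le h3
    (aemeasurable_selfdualIntegrand (ω := ω) hS hφmeas hφcont hT hu)
    (.of_forall fun t => neg_inner_le_selfdualIntegrand ω S φ u t) (by rw [h1, h4])
  filter_upwards [h5, ae_restrict_mem measurableSet_Icc] with t h6 ht
  rw [selfdualIntegrand_eq_iff] at h6
  exact (eq_of_forall_add_inner_le (hφdiff t ht _)
    (forall_add_inner_le_of_conjugate_le h6.le)).symm

omit [CompleteSpace H] [TopologicalSpace.SeparableSpace H] in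
-- Since `y ↦ e^{ωt} S_t y` is onto, a subgradient `-u̇` of the twisted function at `u` becomes the
-- subgradient `-e^{ωt} S_t u̇` of `φ(t, ·)` at `e^{ωt} S_t u`; the constant `κ t` drops out.
theorem selfdualIntegrand_eq_of_subgradient {N : ℝ → H → ℝ} {κ : ℝ → ℝ} {u : ℝ → H} {t : ℝ}
    (hN : ∀ y, N t y = φ t y + κ t)
    (h : ∀ y, Real.exp (-2 * ω * t) * N t (Real.exp (ω * t) • S t (u t)) +
      ⟪-deriv u t, y - u t⟫ ≤ Real.exp (-2 * ω * t) * N t (Real.exp (ω * t) • S t y)) :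
    selfdualIntegrand ω S φ u t = ((-⟪u t, deriv u t⟫ : ℝ) : EReal) := by
  rw [selfdualIntegrand_eq_iff]
  refine conjugate_eq_of_forall_add_inner_le fun y => ?_
  set z : H := (S t).symm (Real.exp (-(ω * t)) • y)
  have hz : Real.exp (ω * t) • S t z = y := by
    rw [LinearIsometryEquiv.apply_symm_apply, smul_smul, ← Real.exp_add, add_neg_cancel,
      Real.exp_zero, one_smul]
  have h1 := h z
  have h2 : ⟪-(Real.exp (ω * t) • S t (deriv u t)), y - Real.exp (ω * t) • S t (u t)⟫ =
      Real.exp (ω * t) * (Real.exp (ω * t) * ⟪-deriv u t, z - u t⟫) := by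
    nth_rewrite 1 [← hz]
    rw [← smul_sub, ← map_sub, ← smul_neg, ← map_neg, real_inner_smul_left,
      real_inner_smul_right, LinearIsometryEquiv.inner_map_map]
  rw [hz, hN, hN, ← exp_weight_mul ω t ⟪-deriv u t, z - u t⟫, ← h2, ← mul_add] at h1
  have h3 := le_of_mul_le_mul_left h1 (Real.exp_pos _)
  linarith

theorem exists_selfdualFunctional_eq_zero (hT : 0 < T) (hS : IsC0UnitaryGroup S)
    (hφmeas : ∀ x, AEMeasurable (fun t => φ t x) (volume.restrict (Icc 0 T)))
    (hφconv : ∀ t ∈ Icc 0 T, ConvexOn ℝ univ (φ t))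
    (hφcont : ∀ t ∈ Icc 0 T, Continuous (φ t))
    {m n C₁ C₂ : ℝ} (hm : 1 < m) (hn : 1 < n) (hC₁ : 0 < C₁) (hC₂ : 0 < C₂)
    (hgrowth : ∀ x : Lp H 2 (volume.restrict (Icc 0 T)),
      ((C₁ * (‖x‖ ^ m - 1) : ℝ) : EReal) ≤
          extIntegral (volume.restrict (Icc 0 T)) (fun t =>
            ((φ t (x t) : ℝ) : EReal) + conjugate ℝ (fun y => ((φ t y : ℝ) : EReal)) 0) ∧
        extIntegral (volume.restrict (Icc 0 T)) (fun t =>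
            ((φ t (x t) : ℝ) : EReal) + conjugate ℝ (fun y => ((φ t y : ℝ) : EReal)) 0) ≤
          ((C₂ * (1 + ‖x‖ ^ n) : ℝ) : EReal))
    {c : ℝ} (hψbdd : ∀ x, (c : EReal) ≤ ψ x)
    (hψconv : EpiConvex ψ) (hψlsc : LowerSemicontinuous ψ) (hψ0 : ψ 0 ≠ ⊤) :
    ∃ u ∈ pathSpace T, selfdualFunctional T ω S φ ψ u = 0 := by
  have hψbot : ∀ x, ψ x ≠ ⊥ := fun x => ne_bot_of_le_ne_bot (EReal.coe_ne_bot c) (hψbdd x)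
  obtain ⟨κ, hκ0, hκ⟩ := exists_normalization_of_growth hφmeas hφcont fun x => (hgrowth x).2
  set N : ℝ → H → ℝ := fun t y => φ t y + κ t with hN
  have hint : ∀ y : Lp H 2 (volume.restrict (Icc 0 T)),
      Integrable (fun t => N t (y t)) (volume.restrict (Icc 0 T)) := fun y => (hκ y).1
  have hlow : ∀ y : Lp H 2 (volume.restrict (Icc 0 T)),
      C₁ * (‖y‖ ^ m - 1) ≤ ∫ t in Icc 0 T, N t (y t) := by
    intro y
    have := (hgrowth y).1
    rwa [(hκ y).2, EReal.coe_le_coe_iff] at this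
  have hupper : ∀ y : Lp H 2 (volume.restrict (Icc 0 T)),
      ∫ t in Icc 0 T, N t (y t) ≤ C₂ * (1 + ‖y‖ ^ n) := by
    intro y
    have := (hgrowth y).2
    rwa [(hκ y).2, EReal.coe_le_coe_iff] at this
  have hNconv : ∀ᵐ t ∂(volume.restrict (Icc 0 T)), ConvexOn ℝ univ (N t) := by
    filter_upwards [ae_restrict_mem measurableSet_Icc] with t ht
    exact (hφconv t ht).add (convexOn_const _ convex_univ)
  have hR := hS.continuous
  have hE : IsClosed {q : H × ℝ | ψ q.1 ≤ (q.2 : EReal)} :=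
    hψlsc.isClosed_epigraph.preimage
      (continuous_id.prodMap continuous_coe_real_ereal : Continuous fun q : H × ℝ =>
        ((q.1, (q.2 : EReal)) : H × EReal))
  obtain ⟨u, u', U, P, β, γ, h1, h2, h3, h4, h5, h6, h7, h8⟩ := exists_selfdual_path hT
    (F := twistedIntegral T ω S N) (convexOn_twistedIntegral hR hκ0 hNconv hint)
    (continuous_twistedIntegral hR hκ0 hNconv hint (by linarith) hC₂.le hupper)
    (twistedIntegral_nonneg hκ0)
    (coercive_twistedIntegral hR hκ0 hint hm.le hC₁ hlow)
    hψconv hE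
    (fun x r s hr hrs => le_trans hr (EReal.coe_le_coe_iff.2 hrs))
    (c := c) (β₀ := (ψ 0).toReal)
    (fun z hz => EReal.coe_le_coe_iff.1 ((hψbdd _).trans hz))
    (EReal.le_coe_toReal hψ0)
  obtain ⟨h9, h10⟩ := mem_pathSpace_of_primitive hT.le h1 h2
  refine ⟨u, h10, le_antisymm ?_ (selfdualFunctional_nonneg hT.le hψbot hψ0 h10)⟩
  have hΦcont : ∀ᵐ t ∂(volume.restrict (Icc 0 T)),
      Continuous fun z => Real.exp (-2 * ω * t) * N t (Real.exp (ω * t) • S t z) := by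
    filter_upwards [ae_restrict_mem measurableSet_Icc] with t ht
    have := hφcont t ht
    have := (S t).continuous
    simp only [hN]
    fun_prop
  have h11 := ae_forall_add_inner_le
    (Φ := fun t z => Real.exp (-2 * ω * t) * N t (Real.exp (ω * t) • S t z))
    (fun x => (twistedIntegral_bounds hR hκ0 hint x).1) hΦcont h8
  have h12 : selfdualIntegrand ω S φ u =ᵐ[volume.restrict (Icc 0 T)]
      fun t => ((-⟪u t, deriv u t⟫ : ℝ) : EReal) := by
    filter_upwards [h3, h9, h11] with t e1 e2 e3
    rw [e1, h4, ← e2] at e3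
    exact selfdualIntegrand_eq_of_subgradient (N := N) (κ := κ) (fun _ => rfl) e3
  obtain ⟨h13, h14⟩ := pathSpace_integral_inner hT.le h10
  rw [selfdualFunctional_eq, extIntegral_congr h12, extIntegral_coe h13, h14]
  have h15 : conjugate ℝ ψ (-((1 / 2 : ℝ) • (u 0 + u T))) ≤ (γ : EReal) :=
    conjugate_le_iff.2 fun x r hr => h6 (x, r) hr
  have h16 : ψ (u 0 - u T) + conjugate ℝ ψ (-((1 / 2 : ℝ) • (u 0 + u T))) ≤
      ((⟪u 0 - u T, -((1 / 2 : ℝ) • (u 0 + u T))⟫ : ℝ) : EReal) := by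
    refine (add_le_add h5 h15).trans ?_
    rw [← EReal.coe_add, EReal.coe_le_coe_iff]
    exact h7
  refine (add_le_add le_rfl h16).trans ?_
  rw [← EReal.coe_add, neg_add_cancel, EReal.coe_zero]

theorem selfdual_principle (hT : 0 < T) (hS : IsC0UnitaryGroup S) {dφ : ℝ → H → H}
    (hφmeas : ∀ x, AEMeasurable (fun t => φ t x) (volume.restrict (Icc 0 T)))
    (hφconv : ∀ t ∈ Icc 0 T, ConvexOn ℝ univ (φ t))
    (hφdiff : ∀ t ∈ Icc 0 T, ∀ x, HasGateauxGradientAt ℝ (φ t) (dφ t x) x)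
    {m n C₁ C₂ : ℝ} (hm : 1 < m) (hn : 1 < n) (hC₁ : 0 < C₁) (hC₂ : 0 < C₂)
    (hgrowth : ∀ x : Lp H 2 (volume.restrict (Icc 0 T)),
      ((C₁ * (‖x‖ ^ m - 1) : ℝ) : EReal) ≤
          extIntegral (volume.restrict (Icc 0 T)) (fun t =>
            ((φ t (x t) : ℝ) : EReal) + conjugate ℝ (fun y => ((φ t y : ℝ) : EReal)) 0) ∧
        extIntegral (volume.restrict (Icc 0 T)) (fun t =>
            ((φ t (x t) : ℝ) : EReal) + conjugate ℝ (fun y => ((φ t y : ℝ) : EReal)) 0) ≤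
          ((C₂ * (1 + ‖x‖ ^ n) : ℝ) : EReal))
    {c : ℝ} (hψbdd : ∀ x, (c : EReal) ≤ ψ x)
    (hψconv : EpiConvex ψ) (hψlsc : LowerSemicontinuous ψ) (hψ0 : ψ 0 ≠ ⊤) :
    IsLeast (selfdualFunctional T ω S φ ψ '' pathSpace T) 0 ∧
      ∀ u ∈ pathSpace T, selfdualFunctional T ω S φ ψ u = 0 →
        ∀ v : ℝ → H, (∀ t, v t = S t (Real.exp (ω * t) • u t)) →
          IsMildSolution T ω S dφ v ∧
          -((1 / 2 : ℝ) • (u 0 + u T)) ∈ subdifferential ℝ ψ (u 0 - u T) := by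
  have hψbot : ∀ x, ψ x ≠ ⊥ := fun x => ne_bot_of_le_ne_bot (EReal.coe_ne_bot c) (hψbdd x)
  refine ⟨⟨?_, ?_⟩, fun u hu hu0 v hv => ?_⟩
  · exact exists_selfdualFunctional_eq_zero hT hS hφmeas hφconv
      (fun t ht => continuous_of_hasGateauxGradientAt (hφconv t ht) (hφdiff t ht))
      hm hn hC₁ hC₂ hgrowth hψbdd hψconv hψlsc hψ0
  · rintro _ ⟨u, hu, rfl⟩
    exact selfdualFunctional_nonneg hT.le hψbot hψ0 hu
  · obtain ⟨h1, h2⟩ := ae_grad_of_selfdualFunctional_eq_zero hT.le hS hφmeas hφconv hφdiff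
      hψbot hψ0 hu hu0
    refine ⟨isMildSolution_of_ae hT.le hS hu hv ?_, h2⟩
    filter_upwards [h1] with t ht
    rwa [hv, map_smul]

end SelfdualPrinciple

/-! ### Passage from `𝕜` to real scalars -/

section RestrictScalars

variable (𝕜 : Type*) [RCLike 𝕜]

/-- The real inner product `Re ⟪x, y⟫`, over the given real normed space structure. -/
abbrev innerProductSpaceReal (H : Type*) [NormedAddCommGroup H] [InnerProductSpace 𝕜 H]
    [NormedSpace ℝ H] [IsScalarTower ℝ 𝕜 H] : InnerProductSpace ℝ H where
  inner x y := RCLike.re (inner 𝕜 x y)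
  norm_sq_eq_re_inner x := norm_sq_eq_re_inner (𝕜 := 𝕜) x
  conj_inner_symm x y := by
    rw [conj_trivial]
    exact inner_re_symm (𝕜 := 𝕜) y x
  add_left x y z := by rw [inner_add_left, map_add]
  smul_left x y r := by
    have h : r • x = (r : 𝕜) • x := by
      rw [RCLike.real_smul_eq_coe_smul (K := 𝕜)]
    rw [h, inner_smul_left, RCLike.conj_ofReal, RCLike.re_ofReal_mul]
    rfl

/-- A linear isometric equivalence over `𝕜`, viewed over `ℝ`. -/
def realIsometry {H : Type*} [NormedAddCommGroup H] [InnerProductSpace 𝕜 H]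
    [NormedSpace ℝ H] [IsScalarTower ℝ 𝕜 H] (e : H ≃ₗᵢ[𝕜] H) : H ≃ₗᵢ[ℝ] H where
  toLinearEquiv := e.toLinearEquiv.restrictScalars ℝ
  norm_map' := e.norm_map

end RestrictScalars

end SelfdualEvolution

end

theorem mainTheorem2
    {𝕜 : Type*} [RCLike 𝕜] {H : Type*} [NormedAddCommGroup H] [InnerProductSpace 𝕜 H]
    [NormedSpace ℝ H] [IsScalarTower ℝ 𝕜 H] [CompleteSpace H] [TopologicalSpace.SeparableSpace H]
    (A : H →ₗ.[𝕜] H) (hA : SelfdualEvolution.IsSkewAdjoint A)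
    (S : ℝ → H ≃ₗᵢ[𝕜] H) (hS : SelfdualEvolution.IsC0UnitaryGroup S)
    (hSA : SelfdualEvolution.IsGenerator S A)
    (T ω : ℝ) (hT : 0 < T)
    (φ : ℝ → H → ℝ) (dφ : ℝ → H → H)
    (hφmeas : ∀ x, AEMeasurable (fun t => φ t x) (volume.restrict (Icc 0 T)))
    (hφconv : ∀ t ∈ Icc 0 T, ConvexOn ℝ univ (φ t))
    (hφdiff : ∀ t ∈ Icc 0 T, ∀ x, SelfdualEvolution.HasGateauxGradientAt 𝕜 (φ t) (dφ t x) x)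
    (m n C₁ C₂ : ℝ) (hm : 1 < m) (hn : 1 < n) (hC₁ : 0 < C₁) (hC₂ : 0 < C₂)
    (hgrowth : ∀ x : Lp H 2 (volume.restrict (Icc 0 T)),
      ((C₁ * (‖x‖ ^ m - 1) : ℝ) : EReal) ≤
          SelfdualEvolution.extIntegral (volume.restrict (Icc 0 T)) (fun t =>
            ((φ t (x t) : ℝ) : EReal) +
              SelfdualEvolution.conjugate 𝕜 (fun y => ((φ t y : ℝ) : EReal)) 0) ∧
        SelfdualEvolution.extIntegral (volume.restrict (Icc 0 T)) (fun t =>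
            ((φ t (x t) : ℝ) : EReal) +
              SelfdualEvolution.conjugate 𝕜 (fun y => ((φ t y : ℝ) : EReal)) 0) ≤
          ((C₂ * (1 + ‖x‖ ^ n) : ℝ) : EReal))
    (ψ : H → EReal) (hψbdd : ∃ c : ℝ, ∀ x, (c : EReal) ≤ ψ x)
    (hψconv : SelfdualEvolution.EpiConvex ψ) (hψlsc : LowerSemicontinuous ψ) (hψ0 : ψ 0 ≠ ⊤) :
    IsLeast (SelfdualEvolution.selfdualFunctional T ω S φ ψ '' SelfdualEvolution.pathSpace T) 0 ∧
      ∀ u ∈ SelfdualEvolution.pathSpace T,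
        SelfdualEvolution.selfdualFunctional T ω S φ ψ u = 0 →
        ∀ v : ℝ → H, (∀ t, v t = S t (Real.exp (ω * t) • u t)) →
          SelfdualEvolution.IsMildSolution T ω S dφ v ∧
          -((1 / 2 : ℝ) • (v 0 + S (-T) (Real.exp (-ω * T) • v T))) ∈
            SelfdualEvolution.subdifferential 𝕜 ψ
              (v 0 - S (-T) (Real.exp (-ω * T) • v T)) ∧
          ((ψ 0 = 0 ∧ ∀ x, x ≠ 0 → ψ x = ⊤) →
            v 0 = S (-T) (Real.exp (-ω * T) • v T)) ∧
          ((∀ x, ψ x = 0) → v 0 = -S (-T) (Real.exp (-ω * T) • v T)) := by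
  -- With `Re ⟪x, y⟫` as inner product, the notions over `𝕜` unfold to those over `ℝ`, so the real
  -- theorem applies by definitional equality.
  let := SelfdualEvolution.innerProductSpaceReal 𝕜 H
  obtain ⟨c, hc⟩ := hψbdd
  have hS' : SelfdualEvolution.IsC0UnitaryGroup
      (fun t => SelfdualEvolution.realIsometry 𝕜 (S t)) := ⟨hS.zero, hS.add, hS.continuous⟩
  obtain ⟨h1, h2⟩ := SelfdualEvolution.selfdual_principle hT hS' (dφ := dφ) (ω := ω) hφmeas hφconv
    hφdiff hm hn hC₁ hC₂ hgrowth hc hψconv hψlsc hψ0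
  refine ⟨h1, fun u hu hu0 v hv => ?_⟩
  obtain ⟨h3, h4⟩ := h2 u hu hu0 v hv
  have hv0 : v 0 = u 0 := by rw [hv, hS.zero, mul_zero, Real.exp_zero, one_smul]
  have hvT : S (-T) (Real.exp (-ω * T) • v T) = u T := by
    have h5 : Real.exp (-ω * T) • v T = S T (u T) := by
      have h6 : v T = Real.exp (ω * T) • S T (u T) := by
        rw [hv]
        exact (SelfdualEvolution.realIsometry 𝕜 (S T)).map_smul _ _
      rw [h6, smul_smul, ← Real.exp_add, neg_mul, neg_add_cancel, Real.exp_zero, one_smul]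
    rw [h5, ← hS.add, neg_add_cancel, hS.zero]
  rw [hv0, hvT]
  refine ⟨h3, h4, fun h => ?_, fun h => ?_⟩
  · by_contra hne
    exact h4.1 (h.2 _ (sub_ne_zero.2 hne))
  · set p : H := -((1 / 2 : ℝ) • (u 0 + u T)) with hp
    -- For `ψ = 0`, moving from the jump in the direction of the subgradient `p` itself gives `‖p‖²
    -- ≤ 0`.
    have h5 := h4.2 (u 0 - u T + p)
    rw [h, h, zero_add, add_sub_cancel_left] at h5
    have h6 : inner ℝ p p ≤ 0 := by exact_mod_cast h5
    have h7 : p = 0 := inner_self_eq_zero.1 (le_antisymm h6 real_inner_self_nonneg)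
    have h8 : u 0 + u T = 0 := by
      rw [hp, neg_eq_zero, smul_eq_zero] at h7
      exact h7.resolve_left (by norm_num)
    exact eq_neg_of_add_eq_zero_left h8
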